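/- **Setup.** Let $n\ge 0$ and let $T^n\subset\mathbb R^{n+1}$ be the standard simplex of nonnegative tuples $(\lambda_0,\dots,\lambda_n)$ with $\lambda_0+\dots+\lambda_n=1$. For $r\in\mathbb Z$ let $\mathcal P_r\Lambda^k(\mathbb R^{n+1})$ be the space of $k$-forms on $\mathbb R^{n+1}$ with polynomial coefficients of degree at most $r$ (it is $0$ if $r<0$). Let $X$ be the position vector field on $\mathbb R^{n+1}$, i.e. $X(\lambda)=\lambda$, and let $\mathcal P_r^-\Lambda^k(\mathbb R^{n+1})$ be the image of $\mathcal P_{r-1}\Lambda^{k+1}(\mathbb R^{n+1})$ under the contraction $i_X$, where $(i_X\alpha)(Y_1,\dots,Y_k)=\alpha(X,Y_1,\dots,Y_k)$. Let $\mathcal P_r\Lambda^k(T^n)$ and $\mathcal P_r^-\Lambda^k(T^n)$ be the images of these spaces under restriction of forms to $T^n$. Let $\mathring{\mathcal P}_r\Lambda^k(T^n)$ and $\mathring{\mathcal P}_r^-\Lambda^k(T^n)$ be their subspaces of forms with vanishing trace on $\partial T^n$, that is, whose pullback to each $(n-1)$-dimensional face of $T^n$ is zero. The symmetric group $S_{n+1}$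 of permutations of $\{0,\dots,n\}$ acts linearly on all these spaces, $\pi$ acting by the pullback $S_\pi^*$ along the map $S_\pi\colon T^n\to T^n$, $S_\pi(\lambda_0,\dots,\lambda_n)=(\lambda_{\pi(0)},\dots,\lambda_{\pi(n)})$. For a group $G$ acting linearly on a real vector space $V$, a *$G$-invariant basis up to sign* is a (finite, possibly empty) basis $\xi_1,\dots,\xi_m$ of $V$ such that for every $g\in G$ and every $i$ there is an $i'$ with $g\xi_i=\xi_{i'}$ or $g\xi_i=-\xi_{i'}$. **Theorem 4.2.** Let $r\in\mathbb Z$, and let $\mathbb N_0=\{0,1,2,\dots\}$. On the tetrahedron $T^3$, the following spaces have $S_4$-invariant bases up to sign if and only if the corresponding condition holds: $$ \begin{array}{ll} \mathcal P_r\Lambda^1(T^3) & \text{always},\\ \mathcal P_r^-\Lambda^1(T^3) & \text{if and only if } r\notin 3\mathbb N_0+2,\\ \mathcal P_r\Lambda^2(T^3) & \text{always},\\ \mathcal P_r^-\Lambda^2(T^3) & \text{always},\\ \mathring{\mathcal P}_r\Lambda^1(T^3) & \text{always},\\ \mathring{\mathcal P}_r^-\Lambda^1(T^3) & \text{always},\\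 \mathring{\mathcal P}_r\Lambda^2(T^3) & \text{if and only if } r\notin 3\mathbb N_0+3,\\ \mathring{\mathcal P}_r^-\Lambda^2(T^3) & \text{always}. \end{array} $$ -/

import Mathlib

namespace FEEC

section Forms

/-- `k`-forms on a space `X` (a subset of an affine space, given as a type) all of whose tangent
spaces are identified with the vector space `T`: to each point an alternating `k`-linear form on
`T`. -/
abbrev Form (X T : Type) [AddCommGroup T] [Module ℝ T] (k : ℕ) : Type :=
  X → T [⋀^Fin k]→ₗ[ℝ] ℝ

variable {X Y T U : Type} [AddCommGroup T] [Module ℝ T] [AddCommGroup U] [Module ℝ U]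

/-- Pullback of `k`-forms along a map `f : X → Y` whose differential is, at every point, the linear
map `L`: `(f^* ω)_x (v₁, …, v_k) = ω_{f x} (L v₁, …, L v_k)`. -/
def pullback (f : X → Y) (L : T →ₗ[ℝ] U) (k : ℕ) : Form Y U k →ₗ[ℝ] Form X T k where
  toFun ω := fun x => (ω (f x)).compLinearMap L
  map_add' _ _ := rfl
  map_smul' _ _ := rfl

@[simp] lemma pullback_apply (f : X → Y) (L : T →ₗ[ℝ] U) (k : ℕ) (ω : Form Y U k) (x : X)
    (v : Fin k → T) : pullback f L k ω x v = ω (f x) (fun j => L (v j)) := rfl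

end Forms

/-- `ℝ^{n+1}`, with coordinates `λ_0, …, λ_n`. -/
abbrev Vec (n : ℕ) : Type := Fin (n + 1) → ℝ

/-- Polynomials on `ℝ^{n+1}` of degree at most `r`; this is `0` when `r < 0`. -/
noncomputable def polyLE (n : ℕ) (r : ℤ) : Submodule ℝ (MvPolynomial (Fin (n + 1)) ℝ) :=
  MvPolynomial.restrictSupport ℝ {m : Fin (n + 1) →₀ ℕ | (m.degree : ℤ) ≤ r}

/-- `P_r Λ^k(ℝ^{n+1})`: the `k`-forms on `ℝ^{n+1}` with polynomial coefficients of degree at most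
`r`. By multilinearity it is the same to ask that all evaluations at constant vectors, or that the
coefficients in the basis `dλ_I`, be such polynomials. -/
def polyFormsAmbient (n : ℕ) (r : ℤ) (k : ℕ) : Submodule ℝ (Form (Vec n) (Vec n) k) where
  carrier := {ω | ∀ v : Fin k → Vec n, ∃ p ∈ polyLE n r, ∀ x, ω x v = MvPolynomial.eval x p}
  zero_mem' := fun _ => ⟨0, zero_mem _, by simp⟩
  add_mem' := by
    intro ω η hω hη v
    obtain ⟨p, hp, hp'⟩ := hω v
    obtain ⟨q, hq, hq'⟩ := hη v
    exact ⟨p + q, add_mem hp hq, fun x => by simp [hp', hq']⟩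
  smul_mem' := by
    intro c ω hω v
    obtain ⟨p, hp, hp'⟩ := hω v
    exact ⟨c • p, Submodule.smul_mem _ c hp, fun x => by simp [hp']⟩

/-- Contraction `i_X` of a `(k+1)`-form on `ℝ^{n+1}` with the position vector field `X`:
`(i_X α)_x (v₁, …, v_k) = α_x (x, v₁, …, v_k)`. -/
def contractX (n k : ℕ) : Form (Vec n) (Vec n) (k + 1) →ₗ[ℝ] Form (Vec n) (Vec n) k where
  toFun α := fun x => (α x).curryLeft x
  map_add' _ _ := rfl
  map_smul' _ _ := rfl

/-- `P_r^- Λ^k(ℝ^{n+1})`, the image of `P_{r-1} Λ^{k+1}(ℝ^{n+1})` under `i_X`. -/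
def trimmedFormsAmbient (n : ℕ) (r : ℤ) (k : ℕ) : Submodule ℝ (Form (Vec n) (Vec n) k) :=
  (polyFormsAmbient n (r - 1) (k + 1)).map (contractX n k)

/-- The standard simplex `T^n ⊂ ℝ^{n+1}`. -/
abbrev Simplex (n : ℕ) : Type := stdSimplex ℝ (Fin (n + 1))

/-- The tangent space of `T^n`: vectors whose components sum to `0`. -/
def tangent (n : ℕ) : Submodule ℝ (Vec n) where
  carrier := {v | ∑ i, v i = 0}
  zero_mem' := by simp
  add_mem' := by
    intro v w hv hw
    simp only [Set.mem_ofPred_eq] at hv hw ⊢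
    simp [Finset.sum_add_distrib, hv, hw]
  smul_mem' := by
    intro c v hv
    simp only [Set.mem_ofPred_eq] at hv ⊢
    simp [← Finset.mul_sum, hv]

/-- `Λ^k(T^n)`. -/
abbrev SimplexForm (n k : ℕ) : Type := Form (Simplex n) (tangent n) k

/-- Restriction of `k`-forms from `ℝ^{n+1}` to `T^n`. -/
def restrict (n k : ℕ) : Form (Vec n) (Vec n) k →ₗ[ℝ] SimplexForm n k :=
  pullback (fun x : Simplex n => (x : Vec n)) (tangent n).subtype k

/-- The `(n-1)`-dimensional face `λ_i = 0` of `T^n`. -/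
abbrev Facet (n : ℕ) (i : Fin (n + 1)) : Type := {x : Simplex n // (x : Vec n) i = 0}

/-- The tangent space of the face `λ_i = 0`, as a subspace of the tangent space of `T^n`. -/
def facetTangent (n : ℕ) (i : Fin (n + 1)) : Submodule ℝ (tangent n) where
  carrier := {v | (v : Vec n) i = 0}
  zero_mem' := by simp
  add_mem' := by
    intro v w hv hw
    simp only [Set.mem_ofPred_eq] at hv hw ⊢
    simp [hv, hw]
  smul_mem' := by
    intro c v hv
    simp only [Set.mem_ofPred_eq] at hv ⊢
    simp [hv]

/-- The trace map `Λ^k(T^n) → Λ^k(F)` for `F` the face `λ_i = 0`. -/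
def trace (n k : ℕ) (i : Fin (n + 1)) :
    SimplexForm n k →ₗ[ℝ] Form (Facet n i) (facetTangent n i) k :=
  pullback (fun x : Facet n i => (x : Simplex n)) (facetTangent n i).subtype k

/-- The action `(λ_0, …, λ_n) ↦ (λ_{π(0)}, …, λ_{π(n)})` of a permutation on `ℝ^{n+1}`. -/
def permVec (n : ℕ) (π : Equiv.Perm (Fin (n + 1))) : Vec n →ₗ[ℝ] Vec n :=
  LinearMap.funLeft ℝ ℝ π

@[simp] lemma permVec_apply (n : ℕ) (π : Equiv.Perm (Fin (n + 1))) (x : Vec n)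
    (i : Fin (n + 1)) : permVec n π x i = x (π i) := rfl

/-- The map `S_π : T^n → T^n`, `(λ_0, …, λ_n) ↦ (λ_{π(0)}, …, λ_{π(n)})`. -/
def permSimplex (n : ℕ) (π : Equiv.Perm (Fin (n + 1))) (x : Simplex n) : Simplex n :=
  ⟨permVec n π x, fun i => x.2.1 (π i), by
    simpa using (Equiv.sum_comp π (fun i => (x : Vec n) i)).trans x.2.2⟩

/-- The differential of `S_π`. -/
def permTangent (n : ℕ) (π : Equiv.Perm (Fin (n + 1))) : tangent n →ₗ[ℝ] tangent n :=
  (permVec n π).restrict fun v (hv : ∑ i, v i = 0) =>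
    show ∑ i, v (π i) = 0 from (Equiv.sum_comp π v).trans hv

/-- The representation of `S_{n+1}` on `Λ^k(T^n)` in which `π` acts by the pullback `S_π^*`. -/
def simplexRep (n k : ℕ) : Representation ℝ (Equiv.Perm (Fin (n + 1))) (SimplexForm n k) where
  toFun π := pullback (permSimplex n π) (permTangent n π) k
  map_one' := rfl
  map_mul' _ _ := rfl

lemma polyLE_rename {n : ℕ} {r : ℤ} (π : Equiv.Perm (Fin (n + 1)))
    {p : MvPolynomial (Fin (n + 1)) ℝ} (hp : p ∈ polyLE n r) :
    MvPolynomial.rename π p ∈ polyLE n r := by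
  rw [polyLE, MvPolynomial.mem_restrictSupport_iff] at hp ⊢
  intro m hm
  rw [Finset.mem_coe, MvPolynomial.support_rename_of_injective π.injective, Finset.mem_image] at hm
  obtain ⟨m', hm', rfl⟩ := hm
  have h := hp hm'
  simp only [Set.mem_ofPred_eq] at h ⊢
  rwa [Finsupp.degree_mapDomain]

/-- Pullback by a permutation of the coordinates of `ℝ^{n+1}` preserves `P_r Λ^k(ℝ^{n+1})`. -/
lemma polyFormsAmbient_perm {n k : ℕ} {r : ℤ} (π : Equiv.Perm (Fin (n + 1)))
    {ω : Form (Vec n) (Vec n) k} (hω : ω ∈ polyFormsAmbient n r k) :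
    pullback (permVec n π) (permVec n π) k ω ∈ polyFormsAmbient n r k := by
  intro v
  obtain ⟨p, hp, hp'⟩ := hω fun j => permVec n π (v j)
  refine ⟨MvPolynomial.rename π p, polyLE_rename π hp, fun x => ?_⟩
  rw [pullback_apply, hp', MvPolynomial.eval_rename]
  rfl

/-- Pullback by a permutation of the coordinates commutes with `i_X`. -/
lemma contractX_perm {n k : ℕ} (π : Equiv.Perm (Fin (n + 1)))
    (α : Form (Vec n) (Vec n) (k + 1)) :
    pullback (permVec n π) (permVec n π) k (contractX n k α)
      = contractX n k (pullback (permVec n π) (permVec n π) (k + 1) α) := by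
  funext x
  ext v
  change α (permVec n π x) (Matrix.vecCons (permVec n π x) fun j => permVec n π (v j))
    = α (permVec n π x) (fun j => permVec n π (Matrix.vecCons x v j))
  congr 1
  funext j
  refine Fin.cases ?_ (fun i => ?_) j <;> simp

/-- `P_r Λ^k(T^n)`, as a subrepresentation of `Λ^k(T^n)`: the image of `P_r Λ^k(ℝ^{n+1})` under
restriction. -/
def polyForms (n : ℕ) (r : ℤ) (k : ℕ) : Subrepresentation (simplexRep n k) where
  toSubmodule := (polyFormsAmbient n r k).map (restrict n k)
  apply_mem_toSubmodule := by
    rintro π _ ⟨ω, hω, rfl⟩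
    exact ⟨_, polyFormsAmbient_perm π hω, rfl⟩

/-- `P_r^- Λ^k(T^n)`, as a subrepresentation of `Λ^k(T^n)`: the image of `P_r^- Λ^k(ℝ^{n+1})` under
restriction. -/
def trimmedForms (n : ℕ) (r : ℤ) (k : ℕ) : Subrepresentation (simplexRep n k) where
  toSubmodule := (trimmedFormsAmbient n r k).map (restrict n k)
  apply_mem_toSubmodule := by
    rintro π _ ⟨_, ⟨α, hα, rfl⟩, rfl⟩
    refine ⟨_, ⟨_, polyFormsAmbient_perm π hα, rfl⟩, ?_⟩
    rw [← contractX_perm]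
    rfl

/-- The `k`-forms on `T^n` with vanishing trace on `∂T^n`, that is, on every `(n-1)`-dimensional
face, as a subrepresentation of `Λ^k(T^n)`. -/
def vanishingTrace (n k : ℕ) : Subrepresentation (simplexRep n k) where
  toSubmodule := ⨅ i, LinearMap.ker (trace n k i)
  apply_mem_toSubmodule := by
    intro π ω hω
    simp only [Submodule.mem_iInf, LinearMap.mem_ker] at hω ⊢
    intro i
    funext x
    ext v
    have hx : ((permSimplex n π x : Simplex n) : Vec n) (π.symm i) = 0 := by
      change ((x : Simplex n) : Vec n) (π (π.symm i)) = 0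
      rw [π.apply_symm_apply]
      exact x.2
    have hv (j : Fin k) : permTangent n π (v j) ∈ facetTangent n (π.symm i) := by
      change ((v j : tangent n) : Vec n) (π (π.symm i)) = 0
      rw [π.apply_symm_apply]
      exact (v j).2
    exact congrArg (fun η => η (fun j => ⟨permTangent n π (v j), hv j⟩))
      (congrFun (hω (π.symm i)) ⟨permSimplex n π x, hx⟩)

/-- The forms in `P_r Λ^k(T^n)` with vanishing trace on `∂T^n`. -/
def polyForms₀ (n : ℕ) (r : ℤ) (k : ℕ) : Subrepresentation (simplexRep n k) :=
  polyForms n r k ⊓ vanishingTrace n k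

/-- The forms in `P_r^- Λ^k(T^n)` with vanishing trace on `∂T^n`. -/
def trimmedForms₀ (n : ℕ) (r : ℤ) (k : ℕ) : Subrepresentation (simplexRep n k) :=
  trimmedForms n r k ⊓ vanishingTrace n k

/-- The representation `ρ` of `G` on `V` has a `G`-invariant basis up to sign: a basis
`ξ₁, …, ξ_m` such that for all `g` and `i` one has `g ξ_i = ± ξ_{i'}` for some `i'`. -/
def HasInvariantBasis {G V : Type} [Group G] [AddCommGroup V] [Module ℝ V]
    (ρ : Representation ℝ G V) : Prop :=
  ∃ (m : ℕ) (ξ : Module.Basis (Fin m) ℝ V),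
    ∀ (g : G) (i : Fin m), ∃ i' : Fin m, ρ g (ξ i) = ξ i' ∨ ρ g (ξ i) = -ξ i'

/-- The space `W`, with the restricted action of `S_{n+1}`, has an `S_{n+1}`-invariant basis up to
sign. -/
def HasInvBasis {n k : ℕ} (W : Subrepresentation (simplexRep n k)) : Prop :=
  HasInvariantBasis (G := Equiv.Perm (Fin (n + 1))) (V := W.toSubmodule) W.toRepresentation

end FEEC

/-! The whole question reduces to the sign of one character value. A real representation of S_4 has
a basis invariant up to sign if and only if a 3-cycle has nonnegative trace
(`hasInvariantBasis_iff_trace_nonneg`). Necessity: an entry -1 on the diagonal of a signed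
permutation matrix would survive cubing. Sufficiency, by induction on the dimension: if the 3-cycle
acts trivially, the representation is a sum of lines on which transpositions act by a common sign.
Otherwise there is a three-dimensional subrepresentation with a signed basis in which the 3-cycle
has no diagonal entry (`exists_orbit_of_ne`). It is either an orbit of Klein four-group
eigenvectors, or a plane representation of S_3 together with a line, the line being available
because the trace is nonnegative. Its trace is zero, so its complement satisfies the same
hypothesis.

For the traces, λ_0, λ_1, λ_2 serve as coordinates and `lam` stands for λ_3. Then 1-forms and
2-forms on the tetrahedron become polynomial vector fields in three variables, and the 3-cycle
rotates the variables and the components simultaneously. On all fields of degree at most m its trace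
is zero, since no component stays in place. On polynomials of degree at most m its trace t(m) counts
the monomials (x_0 x_1 x_2)^a with 3a ≤ m, hence jumps by one exactly when m reaches a nonnegative
multiple of 3.

Each of the eight spaces fits into an equivariant exact sequence of such building blocks. Four are
isomorphic to spaces of fields and have trace 0. Two are cokernels of a map from polynomials of
degree k into fields and polynomials of degree k + 1, with trace t(k+1) - t(k) ≥ 0
(`trace_of_cokernel`). The remaining two, the trimmed 1-forms and the 2-forms with vanishing trace
on the boundary, are kernels of a map (v, g) ↦ x · v - ℓ g onto polynomials of one degree more, with
trace t(m) - t(m+1) for m ≥ 0 (`trace_of_kernel`). This is negative exactly when 3 divides m + 1;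
here m is r and r - 1 respectively, which yields the two exceptional progressions. -/

namespace FEEC

/-! ### Bases invariant up to sign, complements and traces -/

section InvariantBases

variable {G V : Type} [Group G] [AddCommGroup V] [Module ℝ V]

lemma HasInvariantBasis.of_basis {ρ : Representation ℝ G V} {ι : Type} [Finite ι]
    (b : Module.Basis ι ℝ V) (hb : ∀ g i, ∃ j, ρ g (b i) = b j ∨ ρ g (b i) = -b j) :
    HasInvariantBasis ρ := by
  have := Fintype.ofFinite ι
  refine ⟨Fintype.card ι, b.reindex (Fintype.equivFin ι), fun g i => ?_⟩
  obtain ⟨j, hj⟩ := hb g ((Fintype.equivFin ι).symm i)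
  exact ⟨Fintype.equivFin ι j, by simpa using hj⟩

/-- A family of vectors permuted up to sign by the group. -/
def SignedFamily (ρ : Representation ℝ G V) {ι : Type} (b : ι → V) : Prop :=
  ∀ g i, ∃ j, ρ g (b i) = b j ∨ ρ g (b i) = -b j

/-- The subrepresentation spanned by a family of vectors permuted up to sign. -/
def SignedFamily.span {ρ : Representation ℝ G V} {ι : Type} {b : ι → V}
    (hb : SignedFamily ρ b) : Subrepresentation ρ where
  toSubmodule := Submodule.span ℝ (Set.range b)
  apply_mem_toSubmodule g v hv := by
    have : Submodule.span ℝ (Set.range b) ≤ (Submodule.span ℝ (Set.range b)).comap (ρ g) := by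
      rw [Submodule.span_le]
      rintro _ ⟨i, rfl⟩
      obtain ⟨j, hj | hj⟩ := hb g i
      · simpa [hj] using Submodule.subset_span (Set.mem_range_self j)
      · simpa [hj] using Submodule.subset_span (R := ℝ) (Set.mem_range_self j)
    exact this hv

lemma HasInvariantBasis.of_isCompl {ρ : Representation ℝ G V} {ι : Type} [Finite ι] {b : ι → V}
    (hb : SignedFamily ρ b) (hli : LinearIndependent ℝ b) {C : Subrepresentation ρ}
    (hC : IsCompl hb.span.toSubmodule C.toSubmodule)
    (h : HasInvariantBasis C.toRepresentation) : HasInvariantBasis ρ := by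
  obtain ⟨m, ξ, hξ⟩ := h
  let B : Module.Basis (ι ⊕ Fin m) ℝ V :=
    ((Module.Basis.span hli).prod ξ).map (Submodule.prodEquivOfIsCompl _ _ hC)
  have key (p : hb.span.toSubmodule × C.toSubmodule) :
      Submodule.prodEquivOfIsCompl _ _ hC p = (p.1 : V) + p.2 :=
    Submodule.coe_prodEquivOfIsCompl' _ _ hC p
  have hl (i : ι) : B (Sum.inl i) = b i := by
    refine (Module.Basis.map_apply _ _ _).trans ((key _).trans ?_)
    simp [Module.Basis.span_apply hli]
  have hr (i : Fin m) : B (Sum.inr i) = (ξ i : V) := by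
    refine (Module.Basis.map_apply _ _ _).trans ((key _).trans ?_)
    simp
  refine .of_basis B fun g i => ?_
  rcases i with i | i
  · obtain ⟨j, hj⟩ := hb g i
    exact ⟨Sum.inl j, by simpa only [hl] using hj⟩
  · obtain ⟨j, hj⟩ := hξ g i
    refine ⟨Sum.inr j, ?_⟩
    simp only [hr]
    refine hj.imp (fun h => ?_) (fun h => ?_)
    · exact congrArg Subtype.val h
    · exact congrArg Subtype.val h

lemma trace_eq_of_isCompl [FiniteDimensional ℝ V] {ρ : Representation ℝ G V}
    {A B : Subrepresentation ρ} (h : IsCompl A.toSubmodule B.toSubmodule) (g : G) :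
    LinearMap.trace ℝ V (ρ g) = LinearMap.trace ℝ A.toSubmodule (A.toRepresentation g)
      + LinearMap.trace ℝ B.toSubmodule (B.toRepresentation g) := by
  rw [← LinearMap.trace_prodMap', ← LinearMap.trace_conj' _
    (Submodule.prodEquivOfIsCompl _ _ h)]
  congr 1
  ext v
  obtain ⟨w, rfl⟩ := (Submodule.prodEquivOfIsCompl _ _ h).surjective v
  simp [LinearEquiv.conj_apply, Subrepresentation.toRepresentation]

/-- A signed permutation matrix whose cube is the identity has nonnegative trace. -/
lemma HasInvariantBasis.trace_nonneg {ρ : Representation ℝ G V} (h : HasInvariantBasis ρ) {g : G}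
    (hg : g ^ 3 = 1) : 0 ≤ LinearMap.trace ℝ V (ρ g) := by
  obtain ⟨m, ξ, hξ⟩ := h
  rw [LinearMap.trace_eq_matrix_trace ℝ ξ, Matrix.trace]
  refine Finset.sum_nonneg fun i _ => ?_
  rw [Matrix.diag_apply, LinearMap.toMatrix_apply]
  obtain ⟨j, hj | hj⟩ := hξ g i
  · rw [hj, ξ.repr_self, Finsupp.single_apply]
    split_ifs <;> norm_num
  · rw [hj]
    by_cases hij : j = i
    · subst hij
      -- A diagonal entry -1 is impossible because the exponent 3 is odd: it would give `ξ j = -ξ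
      -- j`.
      have h3 : ρ (g ^ 3) (ξ j) = -ξ j := by
        simp [pow_succ, hj]
      rw [hg, map_one, Module.End.one_apply] at h3
      have h2 : (2 : ℝ) • ξ j = 0 := by
        rw [two_smul, ← eq_neg_iff_add_eq_zero]
        exact h3
      exact absurd h2 (by simpa using ξ.ne_zero j)
    · simp [hij]

/-- In the basis `b` of the span, `g` sends no basis vector to a multiple of itself, so the diagonal
of its matrix is zero. -/
lemma trace_eq_zero_of_cyclic {ρ : Representation ℝ G V} {b : Fin 3 → V}
    (hb : SignedFamily ρ b) (hli : LinearIndependent ℝ b) {g : G}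
    (h : ∀ i, ∃ j, j ≠ i ∧ (ρ g (b i) = b j ∨ ρ g (b i) = -b j)) :
    LinearMap.trace ℝ hb.span.toSubmodule (hb.span.toRepresentation g) = 0 := by
  let B : Module.Basis (Fin 3) ℝ hb.span.toSubmodule := Module.Basis.span hli
  have hB (i : Fin 3) : (B i : V) = b i :=
    congrArg Subtype.val (Module.Basis.span_apply hli i)
  rw [LinearMap.trace_eq_matrix_trace ℝ B, Matrix.trace]
  refine Finset.sum_eq_zero fun i _ => ?_
  rw [Matrix.diag_apply, LinearMap.toMatrix_apply]
  obtain ⟨j, hji, hj | hj⟩ := h i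
  · have : hb.span.toRepresentation g (B i) = B j := by
      apply Subtype.ext
      rw [hB, ← hj, ← hB]
      rfl
    rw [this]; simp [hji]
  · have : hb.span.toRepresentation g (B i) = -B j := by
      apply Subtype.ext
      rw [Submodule.coe_neg, hB, ← hj, ← hB]
      rfl
    rw [this]; simp [hji]

end InvariantBases

/-! ### Signed bases for representations of the symmetric group on four letters -/

section SymmetricGroupFour

open Equiv (swap Perm)

/-- The induction step on the dimension: Maschke's theorem supplies an invariant complement of the
span of `b`, which is strictly smaller because `b` is nonempty. -/
lemma HasInvariantBasis.of_signedFamily {G V : Type} [Group G] [Finite G] [AddCommGroup V]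
    [Module ℝ V] [FiniteDimensional ℝ V] {ρ : Representation ℝ G V} {ι : Type} [Finite ι]
    [Nonempty ι] {b : ι → V} (hb : SignedFamily ρ b) (hli : LinearIndependent ℝ b)
    (ih : ∀ C : Subrepresentation ρ, IsCompl hb.span.toSubmodule C.toSubmodule →
      Module.finrank ℝ C.toSubmodule < Module.finrank ℝ V →
      HasInvariantBasis C.toRepresentation) : HasInvariantBasis ρ := by
  obtain ⟨C, hC⟩ := exists_isCompl hb.span
  have hC' : IsCompl hb.span.toSubmodule C.toSubmodule := by
    rw [isCompl_iff, disjoint_iff, codisjoint_iff] at hC ⊢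
    exact ⟨congrArg Subrepresentation.toSubmodule hC.1,
      congrArg Subrepresentation.toSubmodule hC.2⟩
  refine .of_isCompl hb hli hC' (ih C hC' ?_)
  rw [← Submodule.finrank_add_eq_of_isCompl hC', lt_add_iff_pos_left]
  have := Fintype.ofFinite ι
  have h : Module.finrank ℝ hb.span.toSubmodule = Fintype.card ι := finrank_span_eq_card hli
  rw [h]
  exact Fintype.card_pos

lemma signedFamily_of_adjacent_swaps {n : ℕ} {V : Type} [AddCommGroup V] [Module ℝ V]
    {ρ : Representation ℝ (Perm (Fin (n + 1))) V} {ι : Type} {b : ι → V}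
    (h : ∀ (k : Fin n) i, ∃ j, ρ (swap k.castSucc k.succ) (b i) = b j ∨
      ρ (swap k.castSucc k.succ) (b i) = -b j) : SignedFamily ρ b := by
  intro g
  have hg : g ∈ Submonoid.closure (Set.range fun i : Fin n ↦ swap i.castSucc i.succ) := by
    rw [Equiv.Perm.mclosure_swap_castSucc_succ]
    trivial
  induction hg using Submonoid.closure_induction with
  | mem x hx =>
    obtain ⟨k, rfl⟩ := hx
    exact h k
  | one => exact fun i => ⟨i, by simp⟩
  | mul x y _ _ hx hy =>
    intro i
    obtain ⟨j, hj⟩ := hy i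
    obtain ⟨k, hk⟩ := hx j
    refine ⟨k, ?_⟩
    rw [map_mul, Module.End.mul_apply]
    rcases hj with hj | hj <;> rcases hk with hk | hk <;> simp [hj, hk]

variable {V : Type} [AddCommGroup V] [Module ℝ V]

/-- The 3-cycle `0 ↦ 1 ↦ 2 ↦ 0`. -/
abbrev threeCycle : Perm (Fin 4) := swap 0 1 * swap 1 2

/-- For an involution, `w + T w` is fixed; if it vanishes, `w` itself is an eigenvector for -1. -/
lemma exists_sign_eigenvector {T : V →ₗ[ℝ] V} (hT : ∀ v, T (T v) = v) {P : Submodule ℝ V}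
    (hP : ∀ v ∈ P, T v ∈ P) (hne : P ≠ ⊥) :
    ∃ w ∈ P, w ≠ 0 ∧ ∃ η : ℝ, (η = 1 ∨ η = -1) ∧ T w = η • w := by
  obtain ⟨w, hw, hw0⟩ := (Submodule.ne_bot_iff P).1 hne
  by_cases h : w + T w = 0
  · exact ⟨w, hw, hw0, -1, Or.inr rfl, by simpa [eq_neg_iff_add_eq_zero, add_comm] using h⟩
  · exact ⟨w + T w, P.add_mem hw (hP w hw), h, 1, Or.inl rfl, by simp [hT, add_comm]⟩

variable {ρ : Representation ℝ (Perm (Fin 4)) V}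

lemma rep_apply_apply {G : Type} [Group G] {ρ : Representation ℝ G V} (x y : G) (v : V) :
    ρ x (ρ y v) = ρ (x * y) v := by
  rw [map_mul, Module.End.mul_apply]

lemma signedFamily_of_swaps {ι : Type} {b : ι → V}
    (h : ∀ i, (∃ j, ρ (swap 0 1) (b i) = b j ∨ ρ (swap 0 1) (b i) = -b j) ∧
      (∃ j, ρ (swap 1 2) (b i) = b j ∨ ρ (swap 1 2) (b i) = -b j) ∧
      (∃ j, ρ (swap 2 3) (b i) = b j ∨ ρ (swap 2 3) (b i) = -b j)) : SignedFamily ρ b := by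
  refine signedFamily_of_adjacent_swaps fun k i => ?_
  fin_cases k
  exacts [(h i).1, (h i).2.1, (h i).2.2]

/-- The orbit up to sign of a vector on which the Klein four-group acts by a nontrivial
character. -/
lemma klein_orbit {w : V} (hw0 : w ≠ 0) {η : ℝ} (hη : η = 1 ∨ η = -1)
    (ha : ρ (swap 0 1 * swap 2 3) w = w) (hb : ρ (swap 0 2 * swap 1 3) w = -w)
    (hT : ρ (swap 0 1) w = η • w) :
    ∃ b : Fin 3 → V, SignedFamily ρ b ∧ LinearIndependent ℝ b ∧
      ∀ i, ∃ j, j ≠ i ∧ (ρ threeCycle (b i) = b j ∨ ρ threeCycle (b i) = -b j) := by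
  have h2 : ρ (swap 2 3) w = η • w := by
    rw [← hT]
    conv_rhs => rw [← ha, rep_apply_apply]
    congr 1
    simp [← mul_assoc]
  -- The triple will be w, v = (1 2) w, z = (0 1)(1 2) w. The equalities below record the action of
  -- the generators on v and z. Each is an identity in S_4, up to permutations acting on w by a
  -- known sign.
  have e1 : ρ (swap 1 2) (ρ (swap 0 1 * swap 1 2) w) = η • ρ (swap 0 1 * swap 1 2) w := by
    rw [← map_smul, ← hT, rep_apply_apply, rep_apply_apply]
    congr 2; decide
  have e2 : ρ (swap 2 3) (ρ (swap 1 2) w) = -ρ (swap 0 1 * swap 1 2) w := by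
    rw [← map_neg, ← hb, rep_apply_apply, rep_apply_apply]
    congr 2; decide
  have e3 : ρ (swap 2 3) (ρ (swap 0 1 * swap 1 2) w) = -ρ (swap 1 2) w := by
    rw [← map_neg, ← hb, rep_apply_apply, rep_apply_apply]
    congr 2; decide
  have e4 : ρ (swap 0 1) (ρ (swap 0 1 * swap 1 2) w) = ρ (swap 1 2) w := by
    rw [rep_apply_apply]
    congr 2; decide
  have e5 : ρ (swap 1 2) (ρ (swap 1 2) w) = w := by simp [rep_apply_apply]
  have s1 : ρ threeCycle (ρ (swap 1 2) w) = η • w := by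
    rw [← hT, rep_apply_apply]
    congr 2; decide
  have s2 : ρ threeCycle (ρ (swap 0 1 * swap 1 2) w) = η • ρ (swap 1 2) w := by
    rw [← map_smul, ← hT, rep_apply_apply, rep_apply_apply]
    congr 2; decide
  have a1 : ρ (swap 0 1 * swap 2 3) (ρ (swap 1 2) w) = -ρ (swap 1 2) w := by
    rw [← map_neg, ← hb, rep_apply_apply, rep_apply_apply]
    congr 2; decide
  have a2 : ρ (swap 0 1 * swap 2 3) (ρ (swap 0 1 * swap 1 2) w) = -ρ (swap 0 1 * swap 1 2) w := by
    rw [← map_neg, ← hb, rep_apply_apply, rep_apply_apply]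
    congr 2; decide
  have b1 : ρ (swap 0 2 * swap 1 3) (ρ (swap 1 2) w) = ρ (swap 1 2) w := by
    conv_rhs => rw [← ha]
    rw [rep_apply_apply, rep_apply_apply]
    congr 2; decide
  have b2 : ρ (swap 0 2 * swap 1 3) (ρ (swap 0 1 * swap 1 2) w) = -ρ (swap 0 1 * swap 1 2) w := by
    have hc : ρ (swap 0 2 * swap 1 3 * (swap 0 1 * swap 2 3)) w = -w := by
      rw [← rep_apply_apply, ha, hb]
    rw [← map_neg, ← hc, rep_apply_apply, rep_apply_apply]
    congr 2; decide
  have e6 : ρ (swap 0 1) (ρ (swap 1 2) w) = ρ (swap 0 1 * swap 1 2) w := rep_apply_apply _ _ _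
  generalize s0 : ρ (swap 0 1 * swap 1 2) w = z at *
  generalize e7 : ρ (swap 1 2) w = v at *
  have hv0 : v ≠ 0 := by
    rintro rfl
    simp [hw0.symm] at e5
  have hz0 : z ≠ 0 := by
    rintro rfl
    simp [hv0.symm] at e4
  refine ⟨![w, v, z], ?_, ?_, ?_⟩
  · refine signedFamily_of_swaps fun i => ⟨?_, ?_, ?_⟩ <;>
      rcases hη with rfl | rfl <;> simp only [one_smul, neg_smul] at * <;> fin_cases i
    all_goals first
      | exact ⟨0, Or.inl (by assumption)⟩
      | exact ⟨0, Or.inr (by assumption)⟩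
      | exact ⟨1, Or.inl (by assumption)⟩
      | exact ⟨1, Or.inr (by assumption)⟩
      | exact ⟨2, Or.inl (by assumption)⟩
      | exact ⟨2, Or.inr (by assumption)⟩
  · rw [Fintype.linearIndependent_iff]
    intro g hg
    simp only [Fin.sum_univ_three, Matrix.cons_val] at hg
    -- The Klein four-group acts on w, v, z by its three distinct nontrivial characters, so
    -- combining the relation with its two images isolates each coefficient.
    have h1 := congrArg (ρ (swap 0 1 * swap 2 3)) hg
    have h3 := congrArg (ρ (swap 0 2 * swap 1 3)) hg
    simp only [map_add, map_smul, ha, hb, a1, a2, b1, b2, map_zero] at h1 h3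
    have k0 : (2 * g 0) • w = 0 := by
      linear_combination (norm := module) hg + h1
    have k1 : (2 * g 1) • v = 0 := by
      linear_combination (norm := module) hg + h3
    have k2 : (2 * g 2) • z = 0 := by
      linear_combination (norm := module) -h1 - h3
    simp only [smul_eq_zero, mul_eq_zero, OfNat.ofNat_ne_zero, false_or, hw0, hv0, hz0,
      or_false] at k0 k1 k2
    intro i
    fin_cases i <;> assumption
  · intro i
    rcases hη with rfl | rfl <;> simp only [one_smul, neg_smul] at * <;> fin_cases i
    all_goals first
      | exact ⟨0, by decide, Or.inl (by assumption)⟩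
      | exact ⟨0, by decide, Or.inr (by assumption)⟩
      | exact ⟨1, by decide, Or.inl (by assumption)⟩
      | exact ⟨1, by decide, Or.inr (by assumption)⟩
      | exact ⟨2, by decide, Or.inl (by assumption)⟩

/-- A triple spanning the sum of a line on which the group acts by a sign and of the plane
representation of the symmetric group on three letters. -/
lemma plane_orbit {w u : V} (hw0 : w ≠ 0) (hu0 : u ≠ 0) {η : ℝ} (hη : η = 1 ∨ η = -1)
    (hT2 : ∀ v, ρ (swap 2 3) v = ρ (swap 0 1) v) (hw : ρ (swap 0 1) w = η • w)
    (hw' : ρ (swap 1 2) w = η • w) (hu : ρ (swap 0 1) u = η • u)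
    (hsum : u + η • ρ (swap 1 2) u + ρ (swap 0 1) (ρ (swap 1 2) u) = 0) :
    ∃ b : Fin 3 → V, SignedFamily ρ b ∧ LinearIndependent ℝ b ∧
      ∀ i, ∃ j, j ≠ i ∧ (ρ threeCycle (b i) = b j ∨ ρ threeCycle (b i) = -b j) := by
  have hηη : η * η = 1 := by rcases hη with rfl | rfl <;> norm_num
  -- The factor η is chosen so that, up to the common sign η, the transposition (0 1) fixes u and
  -- exchanges v and z, while (1 2) fixes z and exchanges u and v. Adding w, on which both act by η,
  -- turns u, v, z into independent vectors.
  obtain ⟨v, hv⟩ : ∃ v, v = η • ρ (swap 1 2) u := ⟨_, rfl⟩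
  obtain ⟨z, hz⟩ : ∃ z, z = ρ (swap 0 1) (ρ (swap 1 2) u) := ⟨_, rfl⟩
  rw [← hv, ← hz] at hsum
  have c1 : ρ (swap 1 2) u = η • v := by rw [hv, smul_smul, hηη, one_smul]
  have c2 : ρ (swap 1 2) v = η • u := by rw [hv, map_smul, rep_apply_apply]; simp
  have c3 : ρ (swap 0 1) v = η • z := by rw [hv, hz, map_smul]
  have c4 : ρ (swap 0 1) z = η • v := by rw [hz, ← c1, rep_apply_apply]; simp
  have hz' : z = -u - v := by linear_combination (norm := module) hsum
  have c5 : ρ (swap 1 2) z = η • z := by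
    rw [hz', map_sub, map_neg, c1, c2]; module
  have huv : u - v ≠ 0 := by
    intro h
    rw [sub_eq_zero] at h
    subst h
    have h3 : u = z := by
      have : η • u = η • z := by rw [← c3, hu]
      simpa [smul_smul, hηη] using congrArg (η • ·) this
    subst h3
    exact hu0 (by simpa using
      (by linear_combination (norm := module) hsum : (3 : ℝ) • u = 0))
  have hvz : v - z ≠ 0 := by
    intro h
    rw [sub_eq_zero] at h
    subst h
    refine huv (sub_eq_zero.2 ?_)
    have : η • u = η • v := by rw [← c2, c5]
    simpa [smul_smul, hηη] using congrArg (η • ·) this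
  refine ⟨![w + u, w + v, w + z], ?_, ?_, ?_⟩
  · clear hsum hv hz hz'
    refine signedFamily_of_swaps fun i => ⟨?_, ?_, ?_⟩ <;> (try simp only [hT2]) <;>
      rcases hη with rfl | rfl <;> simp only [one_smul, neg_smul] at * <;> fin_cases i
    all_goals first
      | (refine ⟨0, Or.inl ?_⟩; simp [*]; done)
      | (refine ⟨0, Or.inr ?_⟩; simp [*]; (try abel1); done)
      | (refine ⟨1, Or.inl ?_⟩; simp [*]; done)
      | (refine ⟨1, Or.inr ?_⟩; simp [*]; (try abel1); done)
      | (refine ⟨2, Or.inl ?_⟩; simp [*]; done)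
      | (refine ⟨2, Or.inr ?_⟩; simp [*]; (try abel1); done)
  · rw [Fintype.linearIndependent_iff]
    intro g hg
    simp only [Fin.sum_univ_three, Matrix.cons_val] at hg
    have h1 := congrArg (η • ρ (swap 0 1) ·) hg
    have h3 := congrArg (η • ρ (swap 1 2) ·) hg
    simp only [map_add, map_smul, hw, hw', hu, c1, c2, c3, c4, c5, map_zero, smul_zero,
      smul_add, smul_smul] at h1 h3
    have e (c : ℝ) : η * (c * η) = c := by rw [mul_left_comm, hηη, mul_one]
    simp only [e] at h1 h3
    have k1 : (g 1 - g 2) • (v - z) = 0 := by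
      linear_combination (norm := module) hg - h1
    have k0 : (g 0 - g 1) • (u - v) = 0 := by
      linear_combination (norm := module) hg - h3
    simp only [smul_eq_zero, hvz, huv, or_false, sub_eq_zero] at k0 k1
    -- All coefficients are now equal, and the triple sums to 3w because u + v + z = 0.
    have k2 : (3 * g 2) • w = 0 := by
      rw [k0, k1] at hg
      linear_combination (norm := module) hg - g 2 • hsum
    simp only [smul_eq_zero, mul_eq_zero, OfNat.ofNat_ne_zero, false_or, hw0, or_false] at k2
    rw [k2] at k1
    rw [k1] at k0
    intro i
    fin_cases i <;> assumption
  · intro i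
    have e (x : V) : η • η • x = x := by rw [smul_smul, hηη, one_smul]
    fin_cases i
    · exact ⟨2, by decide, Or.inl (by simp [hw, hw', c1, c3, e])⟩
    · exact ⟨0, by decide, Or.inl (by simp [hw, hw', c2, hu, e])⟩
    · exact ⟨1, by decide, Or.inl (by simp [hw, hw', c5, c4, e])⟩

/-- If no vector is acted on by the Klein four-group through its nontrivial character trivial on
`(0 1)(2 3)`, then the Klein four-group acts trivially. -/
lemma klein_trivial
    (h : ∀ w, ρ (swap 0 1 * swap 2 3) w = w → ρ (swap 0 2 * swap 1 3) w = -w → w = 0) (v : V) :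
    ρ (swap 2 3) v = ρ (swap 0 1) v := by
  have hcomm (x y z t : Perm (Fin 4)) (hxy : x * y = z * t) (v : V) :
      ρ x (ρ y v) = ρ z (ρ t v) := by rw [rep_apply_apply, rep_apply_apply, hxy]
  -- The three nontrivial characters of the Klein four-group are conjugate in S_4, so excluding one
  -- excludes the other two.
  have h1 (y : V) (ha : ρ (swap 0 1 * swap 2 3) y = -y)
      (hb : ρ (swap 0 2 * swap 1 3) y = y) : y = 0 := by
    have := h (ρ (swap 1 2) y)
      (by rw [hcomm _ _ (swap 1 2) (swap 0 2 * swap 1 3) (by decide), hb])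
      (by rw [hcomm _ _ (swap 1 2) (swap 0 1 * swap 2 3) (by decide), ha, map_neg])
    simpa [rep_apply_apply] using congrArg (ρ (swap 1 2)) this
  have h2 (y : V) (ha : ρ (swap 0 1 * swap 2 3) y = -y)
      (hb : ρ (swap 0 2 * swap 1 3) y = -y) : y = 0 := by
    have := h1 (ρ (swap 0 1) y)
      (by rw [hcomm _ _ (swap 0 1) (swap 0 1 * swap 2 3) (by decide), ha, map_neg])
      (by rw [hcomm _ _ (swap 0 1 * (swap 0 2 * swap 1 3)) (swap 0 1 * swap 2 3) (by decide), ha,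
        map_neg, ← rep_apply_apply, hb, map_neg, neg_neg])
    simpa [rep_apply_apply] using congrArg (ρ (swap 0 1)) this
  have haa (v : V) : ρ (swap 0 1 * swap 2 3) (ρ (swap 0 1 * swap 2 3) v) = v := by
    rw [hcomm _ _ 1 1 (by decide)]; simp
  have hbb (v : V) : ρ (swap 0 2 * swap 1 3) (ρ (swap 0 2 * swap 1 3) v) = v := by
    rw [hcomm _ _ 1 1 (by decide)]; simp
  have hab (v : V) : ρ (swap 0 1 * swap 2 3) (ρ (swap 0 2 * swap 1 3) v)
      = ρ (swap 0 2 * swap 1 3) (ρ (swap 0 1 * swap 2 3) v) := hcomm _ _ _ _ (by decide) v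
  have ha (v : V) : ρ (swap 0 1 * swap 2 3) v = v := by
    -- The vector v - (0 1)(2 3) v lies in the -1 eigenspace of (0 1)(2 3). Its symmetric and
    -- antisymmetric parts under (0 2)(1 3) carry nontrivial characters, hence vanish.
    have k1 := h1 (v - ρ (swap 0 1 * swap 2 3) v
      + ρ (swap 0 2 * swap 1 3) (v - ρ (swap 0 1 * swap 2 3) v))
      (by simp only [map_add, map_sub, haa, hab]; abel)
      (by simp only [map_add, map_sub, hbb]; abel)
    have k2 := h2 (v - ρ (swap 0 1 * swap 2 3) v
      - ρ (swap 0 2 * swap 1 3) (v - ρ (swap 0 1 * swap 2 3) v))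
      (by simp only [map_sub, haa, hab]; abel)
      (by simp only [map_sub, hbb]; abel)
    have : (2 : ℝ) • (v - ρ (swap 0 1 * swap 2 3) v) = 0 := by
      linear_combination (norm := module) k1 + k2
    simp only [smul_eq_zero, OfNat.ofNat_ne_zero, false_or, sub_eq_zero] at this
    exact this.symm
  have := ha (ρ (swap 2 3) v)
  rw [rep_apply_apply] at this
  rw [← this]
  congr 2
  simp [mul_assoc]

/-- Averaging over the powers of the 3-cycle projects onto its fixed space. The square is conjugate
to the 3-cycle and has the same trace, so the fixed space has dimension (dim V + 2 tr)/3 > 0. -/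
lemma exists_threeCycle_invariant [FiniteDimensional ℝ V] [Nontrivial V]
    (h : 0 ≤ LinearMap.trace ℝ V (ρ threeCycle)) :
    LinearMap.ker (ρ threeCycle - 1) ≠ ⊥ := by
  have h3 (v : V) : ρ threeCycle (ρ threeCycle (ρ threeCycle v)) = v := by
    rw [rep_apply_apply, rep_apply_apply,
      show threeCycle * threeCycle * threeCycle = 1 by decide]
    simp
  have hp : LinearMap.IsProj (LinearMap.ker (ρ threeCycle - 1))
      ((1 / 3 : ℝ) • (1 + ρ threeCycle + ρ threeCycle * ρ threeCycle)) := by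
    refine ⟨fun v => ?_, fun v hv => ?_⟩
    · simp only [LinearMap.mem_ker, LinearMap.sub_apply, LinearMap.smul_apply,
        LinearMap.add_apply, Module.End.mul_apply, Module.End.one_apply, map_smul, map_add, h3]
      module
    · have : ρ threeCycle v = v := by simpa [sub_eq_zero] using hv
      simp only [LinearMap.smul_apply, LinearMap.add_apply, Module.End.mul_apply,
        Module.End.one_apply, this]
      module
  have h2 : LinearMap.trace ℝ V (ρ threeCycle * ρ threeCycle)
      = LinearMap.trace ℝ V (ρ threeCycle) := by
    rw [← map_mul, show threeCycle * threeCycle = swap 0 1 * threeCycle * swap 0 1 by decide,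
      map_mul, LinearMap.trace_mul_comm, ← map_mul]
    congr 2
    simp [← mul_assoc]
  have ht := hp.trace
  rw [map_smul, map_add, map_add, h2, LinearMap.trace_one, smul_eq_mul] at ht
  have hpos : (0 : ℝ) < Module.finrank ℝ V := by exact_mod_cast Module.finrank_pos
  intro hbot
  rw [hbot, finrank_bot] at ht
  push_cast at ht
  linarith

/-- If the Klein four-group acts nontrivially, an eigenvector for a nontrivial character generates
the triple. Otherwise the action factors through S_3. A 3-cycle acts nontrivially there only on
planes, where its trace is -1, so nonnegative trace forces a line as well. The sign of the line is
immaterial, because the plane representation is isomorphic to its twist by the sign. -/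
lemma exists_orbit_of_ne [FiniteDimensional ℝ V]
    (h : 0 ≤ LinearMap.trace ℝ V (ρ threeCycle)) (hne : ρ threeCycle ≠ 1) :
    ∃ b : Fin 3 → V, SignedFamily ρ b ∧ LinearIndependent ℝ b ∧
      ∀ i, ∃ j, j ≠ i ∧ (ρ threeCycle (b i) = b j ∨ ρ threeCycle (b i) = -b j) := by
  have hTT (x : V) : ρ (swap 0 1) (ρ (swap 0 1) x) = x := by simp [rep_apply_apply]
  by_cases hk : ∀ w, ρ (swap 0 1 * swap 2 3) w = w → ρ (swap 0 2 * swap 1 3) w = -w → w = 0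
  · have hT2 := klein_trivial hk
    obtain ⟨v, hv⟩ : ∃ v, ρ threeCycle v ≠ v := by
      by_contra! hall
      exact hne (LinearMap.ext hall)
    have : Nontrivial V := ⟨_, _, hv⟩
    obtain ⟨w, hwF, hw0, η, hη, hw⟩ := exists_sign_eigenvector hTT
      (P := LinearMap.ker (ρ threeCycle - 1)) (fun x hx => by
        have hx : ρ threeCycle x = x := by simpa [sub_eq_zero] using hx
        have : ρ threeCycle (ρ (swap 0 1) x) = ρ (swap 0 1) x := by
          conv_lhs => rw [← hx]
          simp only [rep_apply_apply]
          congr 2; decide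
        simpa [sub_eq_zero] using this) (exists_threeCycle_invariant h)
    have hwF : ρ threeCycle w = w := by simpa [sub_eq_zero] using hwF
    have hw' : ρ (swap 1 2) w = η • w := by
      rw [← hw]
      conv_rhs => rw [← hwF, rep_apply_apply]
      congr 2; decide
    have hηη : η * η = 1 := by rcases hη with rfl | rfl <;> norm_num
    -- Having zero sum over the powers of the 3-cycle survives projection to the η-eigenspace of (0
    -- 1), because (0 1) conjugates the 3-cycle to its inverse.
    have key (x : V) (hx : x + ρ threeCycle x + ρ (threeCycle * threeCycle) x = 0) :
        (x + η • ρ (swap 0 1) x) + ρ threeCycle (x + η • ρ (swap 0 1) x)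
          + ρ (threeCycle * threeCycle) (x + η • ρ (swap 0 1) x) = 0 := by
      have := congrArg (η • ρ (swap 0 1) ·) hx
      simp only [map_add, map_smul, map_zero, smul_zero, rep_apply_apply] at this ⊢
      rw [show swap 0 1 * threeCycle = threeCycle * threeCycle * swap 0 1 by decide,
        show swap 0 1 * (threeCycle * threeCycle) = threeCycle * swap 0 1 by decide] at this
      linear_combination (norm := module) hx + this
    have fin (u : V) (hu0 : u ≠ 0) (hu : ρ (swap 0 1) u = η • u)
        (hs : u + ρ threeCycle u + ρ (threeCycle * threeCycle) u = 0) := by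
      refine plane_orbit hw0 hu0 hη hT2 hw hw' hu ?_
      rw [← map_smul, ← hu, rep_apply_apply, rep_apply_apply, ← hs,
        show swap 1 2 * swap 0 1 = threeCycle * threeCycle by decide]
      abel
    have hη2 (x : V) : ρ (swap 0 1) (x + η • ρ (swap 0 1) x) = η • (x + η • ρ (swap 0 1) x) := by
      rw [map_add, map_smul, hTT, smul_add, smul_smul, hηη, one_smul, add_comm]
    set y := v - ρ threeCycle v with hy
    have hy0 : y ≠ 0 := sub_ne_zero.2 hv.symm
    have hysum : y + ρ threeCycle y + ρ (threeCycle * threeCycle) y = 0 := by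
      rw [hy]
      simp only [map_sub, rep_apply_apply]
      rw [show threeCycle * threeCycle * threeCycle = 1 by decide, map_one, Module.End.one_apply]
      abel
    -- If both y and its image under the 3-cycle had zero projection to the η-eigenspace of (0 1),
    -- the 3-cycle would fix y, and the zero sum would give 3y = 0.
    by_cases h1 : y + η • ρ (swap 0 1) y = 0
    · by_cases h2 : ρ threeCycle y + η • ρ (swap 0 1) (ρ threeCycle y) = 0
      · exfalso
        have e1 : ρ (swap 0 1) y = -(η • y) := by
          have := congrArg (η • ·) h1
          simp only [smul_add, smul_smul, hηη, one_smul, smul_zero] at this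
          linear_combination (norm := module) this
        have e2 : ρ (swap 1 2) y = -(η • ρ threeCycle y) := by
          have := congrArg (η • ·) h2
          simp only [smul_add, smul_smul, hηη, one_smul, smul_zero, rep_apply_apply] at this
          rw [show swap 0 1 * threeCycle = swap 1 2 by decide] at this
          linear_combination (norm := module) this
        have e3 : ρ (threeCycle * threeCycle) y = ρ threeCycle y := by
          rw [show threeCycle * threeCycle = swap 1 2 * swap 0 1 by decide, ← rep_apply_apply, e1,
            map_neg, map_smul, e2, smul_neg, smul_smul, hηη, one_smul, neg_neg]
        have e4 : ρ threeCycle y = y := by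
          have := congrArg (ρ (threeCycle * threeCycle)) e3
          simp only [rep_apply_apply] at this
          rw [show threeCycle * threeCycle * (threeCycle * threeCycle) = threeCycle by decide,
            show threeCycle * threeCycle * threeCycle = 1 by decide] at this
          simpa using this
        rw [e3, e4] at hysum
        have : (3 : ℝ) • y = 0 := by linear_combination (norm := module) hysum
        exact hy0 (by simpa using this)
      · refine fin _ h2 (hη2 _) (key _ ?_)
        have := congrArg (ρ threeCycle) hysum
        simp only [map_add, map_zero, rep_apply_apply] at this ⊢
        rw [← mul_assoc] at this
        exact this
    · exact fin _ h1 (hη2 _) (key _ hysum)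
  · push Not at hk
    obtain ⟨w, ha, hb, hw0⟩ := hk
    -- The eigenspace of the character is stable under (0 1), which fixes (0 1)(2 3) under
    -- conjugation and sends (0 2)(1 3) to its product with it.
    obtain ⟨x, ⟨hxa, hxb⟩, hx0, η, hη, hx⟩ := exists_sign_eigenvector hTT
      (P := LinearMap.ker (ρ (swap 0 1 * swap 2 3) - 1) ⊓
        LinearMap.ker (ρ (swap 0 2 * swap 1 3) + 1)) (by
        rintro x ⟨hxa, hxb⟩
        have hxa : ρ (swap 0 1 * swap 2 3) x = x := by simpa [sub_eq_zero] using hxa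
        have hxb : ρ (swap 0 2 * swap 1 3) x = -x := by
          simpa [eq_neg_iff_add_eq_zero] using hxb
        have e1 : ρ (swap 0 1 * swap 2 3) (ρ (swap 0 1) x) = ρ (swap 0 1) x := by
          conv_rhs => rw [← hxa]
          rw [rep_apply_apply, rep_apply_apply]
          congr 2; decide
        have e2 : ρ (swap 0 2 * swap 1 3) (ρ (swap 0 1) x) = -ρ (swap 0 1) x := by
          rw [← map_neg, ← hxb]
          conv_rhs => rw [← hxa]
          rw [rep_apply_apply, rep_apply_apply, rep_apply_apply]
          congr 2; decide
        constructor
        · simpa [sub_eq_zero] using e1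
        · simpa [← eq_neg_iff_add_eq_zero] using e2)
      ((Submodule.ne_bot_iff _).2 ⟨w, ⟨by simpa [sub_eq_zero] using ha,
        by simpa [← eq_neg_iff_add_eq_zero] using hb⟩, hw0⟩)
    exact klein_orbit hx0 hη (by simpa [sub_eq_zero] using hxa)
      (by simpa [← eq_neg_iff_add_eq_zero] using hxb) hx

/-- A real representation of the symmetric group on four letters in which the 3-cycles have
nonnegative trace has a basis that is invariant up to sign. -/
theorem hasInvariantBasis_of_trace_nonneg {V : Type} [AddCommGroup V] [Module ℝ V]
    [FiniteDimensional ℝ V] {ρ : Representation ℝ (Perm (Fin 4)) V}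
    (h : 0 ≤ LinearMap.trace ℝ V (ρ threeCycle)) : HasInvariantBasis ρ := by
  induction hn : Module.finrank ℝ V using Nat.strong_induction_on generalizing V with
  | _ n ih =>
  subst hn
  by_cases hs : ρ threeCycle = 1
  · rcases subsingleton_or_nontrivial V with hV | hV
    · exact .of_basis (Module.Basis.empty V (ι := Fin 0)) fun _ i => i.elim0
    have hTT (x : V) : ρ (swap 0 1) (ρ (swap 0 1) x) = x := by simp [rep_apply_apply]
    obtain ⟨w, -, hw0, η, hη, hw⟩ := exists_sign_eigenvector hTT (P := ⊤) (fun _ _ => trivial)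
      top_ne_bot
    have hs' (x : V) : ρ threeCycle x = x := by rw [hs]; rfl
    have h1 : ρ (swap 1 2) w = ρ (swap 0 1) w := by
      conv_rhs => rw [← hs' w, rep_apply_apply]
      congr 2; decide
    have h2 : ρ (swap 2 3) w = ρ (swap 0 1) w := by
      refine klein_trivial (fun x hxa hxb => ?_) w
      -- The 3-cycle conjugates (0 2)(1 3) to (0 1)(2 3); as it acts trivially, these act alike.
      have : ρ (swap 0 2 * swap 1 3) x = ρ (swap 0 1 * swap 2 3) x := by
        conv_lhs => rw [← hs' (ρ _ x)]
        conv_rhs => rw [← hs' x]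
        simp only [rep_apply_apply]
        rw [show threeCycle * (swap 0 2 * swap 1 3)
          = swap 0 1 * swap 2 3 * (threeCycle : Perm (Fin 4)) by decide]
      rw [hxa, hxb] at this
      have : (2 : ℝ) • x = 0 := by linear_combination (norm := module) -this
      simpa using this
    have hb : SignedFamily ρ (fun _ : Fin 1 => w) := by
      refine signedFamily_of_swaps fun i => ?_
      rw [h1, h2, hw]
      rcases hη with rfl | rfl <;> simp
    refine .of_signedFamily hb (LinearIndependent.of_subsingleton 0 hw0) fun C hC hlt =>
      ih _ hlt ?_ rfl
    have : C.toRepresentation threeCycle = 1 := by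
      ext x
      exact hs' x
    rw [this, LinearMap.trace_one]
    positivity
  · obtain ⟨b, hb, hli, hcyc⟩ := exists_orbit_of_ne h hs
    refine .of_signedFamily hb hli fun C hC hlt => ih _ hlt ?_ rfl
    -- The split-off block has trace zero, so the complement inherits the full nonnegative trace.
    rwa [trace_eq_of_isCompl hC, trace_eq_zero_of_cyclic hb hli hcyc, zero_add] at h

theorem hasInvariantBasis_iff_trace_nonneg {V : Type} [AddCommGroup V] [Module ℝ V]
    [FiniteDimensional ℝ V] {ρ : Representation ℝ (Perm (Fin 4)) V} :
    HasInvariantBasis ρ ↔ 0 ≤ LinearMap.trace ℝ V (ρ threeCycle) :=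
  ⟨fun h => h.trace_nonneg (by decide), hasInvariantBasis_of_trace_nonneg⟩

end SymmetricGroupFour

/-! ### Additivity of traces in exact sequences -/

section Traces

lemma trace_eq_add_of_exact {A B K : Type} [AddCommGroup A] [Module ℝ A] [AddCommGroup B]
    [Module ℝ B] [AddCommGroup K] [Module ℝ K] [FiniteDimensional ℝ A] [FiniteDimensional ℝ B]
    [FiniteDimensional ℝ K] {j : K →ₗ[ℝ] A} {f : A →ₗ[ℝ] B} (hj : Function.Injective j)
    (hf : Function.Surjective f) (hjf : ∀ x, f x = 0 ↔ ∃ y, j y = x)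
    {k : K →ₗ[ℝ] K} {a : A →ₗ[ℝ] A} {b : B →ₗ[ℝ] B} (hk : ∀ y, j (k y) = a (j y))
    (hb : ∀ x, f (a x) = b (f x)) :
    LinearMap.trace ℝ A a = LinearMap.trace ℝ K k + LinearMap.trace ℝ B b := by
  obtain ⟨g, hg⟩ := f.exists_rightInverse_of_surjective (LinearMap.range_eq_top.2 hf)
  obtain ⟨p, hp⟩ := j.exists_leftInverse_of_injective (LinearMap.ker_eq_bot.2 hj)
  have hg' (x : B) : f (g x) = x := congrArg (· x) hg
  have hp' (x : K) : p (j x) = x := congrArg (· x) hp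
  have hsplit (x : A) : j (p (x - g (f x))) = x - g (f x) := by
    obtain ⟨y, hy⟩ := (hjf (x - g (f x))).1 (by simp [hg'])
    rw [← hy, hp']
  -- A linear splitting writes `a` as two operators factoring through `K` and `B`; exchanging the
  -- factors under the trace turns them into `k` and `b`. The splitting need not be equivariant.
  have e : a = (a ∘ₗ j) ∘ₗ (p ∘ₗ (LinearMap.id - g ∘ₗ f)) + (a ∘ₗ g) ∘ₗ f := by
    ext x
    change a x = a (j (p (x - g (f x)))) + a (g (f x))
    rw [hsplit, ← map_add, sub_add_cancel]
  have e1 : (p ∘ₗ (LinearMap.id - g ∘ₗ f)) ∘ₗ (a ∘ₗ j) = k := by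
    ext x
    change p (a (j x) - g (f (a (j x)))) = k x
    rw [← hk, (hjf (j (k x))).2 ⟨_, rfl⟩, map_zero, sub_zero, hp']
  have e2 : f ∘ₗ (a ∘ₗ g) = b := by
    ext x
    simp [hb, hg']
  conv_lhs => rw [e]
  rw [map_add, LinearMap.trace_comp_comm', e1, LinearMap.trace_comp_comm', e2]

/-- The trace on a subrepresentation that is given as the cokernel of an equivariant map. -/
lemma trace_toRepresentation_of_exact {G V M K : Type} [Group G] [AddCommGroup V] [Module ℝ V]
    [AddCommGroup M] [Module ℝ M] [AddCommGroup K] [Module ℝ K] [FiniteDimensional ℝ M]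
    [FiniteDimensional ℝ K] {ρ : Representation ℝ G V} {W : Subrepresentation ρ} {g : G}
    {j : K →ₗ[ℝ] M} {f : M →ₗ[ℝ] V} (hj : Function.Injective j)
    (hW : LinearMap.range f = W.toSubmodule) (hjf : ∀ x, f x = 0 ↔ ∃ y, j y = x)
    {k : K →ₗ[ℝ] K} {a : M →ₗ[ℝ] M} (hk : ∀ y, j (k y) = a (j y))
    (hf : ∀ x, f (a x) = ρ g (f x)) :
    FiniteDimensional ℝ W.toSubmodule ∧
    LinearMap.trace ℝ W.toSubmodule (W.toRepresentation g)
      = LinearMap.trace ℝ M a - LinearMap.trace ℝ K k := by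
  have hmem (x : M) : f x ∈ W.toSubmodule := hW ▸ LinearMap.mem_range_self f x
  have hsurj : Function.Surjective (f.codRestrict W.toSubmodule hmem) := by
    rintro ⟨w, hw⟩
    rw [← hW] at hw
    obtain ⟨x, rfl⟩ := hw
    exact ⟨x, rfl⟩
  have : FiniteDimensional ℝ W.toSubmodule := Module.Finite.of_surjective _ hsurj
  refine ⟨this, ?_⟩
  rw [trace_eq_add_of_exact (f := f.codRestrict W.toSubmodule hmem) hj hsurj
    (fun x => by rw [← hjf, ← Subtype.coe_inj]; rfl) hk
    (b := W.toRepresentation g) (fun x => Subtype.ext (hf x))]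
  ring

lemma trace_toRepresentation_of_injective {G V M : Type} [Group G] [AddCommGroup V] [Module ℝ V]
    [AddCommGroup M] [Module ℝ M] [FiniteDimensional ℝ M]
    {ρ : Representation ℝ G V} {W : Subrepresentation ρ} {g : G} {f : M →ₗ[ℝ] V}
    (hW : LinearMap.range f = W.toSubmodule) (hinj : ∀ x, f x = 0 → x = 0)
    {a : M →ₗ[ℝ] M} (hf : ∀ x, f (a x) = ρ g (f x)) :
    FiniteDimensional ℝ W.toSubmodule ∧
    LinearMap.trace ℝ W.toSubmodule (W.toRepresentation g) = LinearMap.trace ℝ M a := by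
  have := trace_toRepresentation_of_exact (K := PUnit) (j := 0) (k := 0)
    (Function.injective_of_subsingleton _) hW
    (fun x => ⟨fun h => ⟨0, by simp [hinj x h]⟩, by rintro ⟨y, rfl⟩; simp⟩) (fun _ => by simp) hf
  simpa using this

/-- An operator on `M^n` composed of a permutation of the factors without fixed points and of an
operator on `M` has trace zero. -/
lemma trace_pi_comp_perm_eq_zero {n : ℕ} {M : Type} [AddCommGroup M] [Module ℝ M]
    [FiniteDimensional ℝ M] (π : Fin n → Fin n) (hπ : ∀ i, π i ≠ i) (f : M →ₗ[ℝ] M) :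
    LinearMap.trace ℝ (Fin n → M) (LinearMap.pi fun i => f ∘ₗ LinearMap.proj (π i)) = 0 := by
  have e : (LinearMap.pi fun i => f ∘ₗ LinearMap.proj (π i) : (Fin n → M) →ₗ[ℝ] (Fin n → M))
      = ∑ i, LinearMap.single ℝ (fun _ => M) i ∘ₗ (f ∘ₗ LinearMap.proj (π i)) := by
    ext i x j
    simp [Finset.sum_apply, Pi.single_apply]
  rw [e, map_sum]
  refine Finset.sum_eq_zero fun i _ => ?_
  rw [LinearMap.trace_comp_comm', LinearMap.comp_assoc]
  have : LinearMap.proj (π i) ∘ₗ LinearMap.single ℝ (fun _ => M) i = 0 := by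
    ext x
    simp [hπ i]
  rw [this, LinearMap.comp_zero, map_zero]

end Traces

/-! ### The trace of the rotation on polynomials and fields of bounded degree -/

section CyclicPolynomials

open MvPolynomial

instance (r : ℤ) : Finite {m : Fin 3 →₀ ℕ | (m.degree : ℤ) ≤ r} :=
  ((Finsupp.finite_of_degree_le (σ := Fin 3) r.toNat).subset fun m hm => by
    simp only [Set.mem_ofPred_eq] at hm ⊢; omega).to_subtype

instance (r : ℤ) : FiniteDimensional ℝ (polyLE 2 r) :=
  Module.Finite.of_basis (basisRestrictSupport ℝ {m : Fin 3 →₀ ℕ | (m.degree : ℤ) ≤ r})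

/-- The cyclic permutation of the variables, on polynomials of degree at most `r`. -/
noncomputable def cycPoly (r : ℤ) : polyLE 2 r →ₗ[ℝ] polyLE 2 r :=
  (rename (R := ℝ) (finRotate 3)).toLinearMap.restrict fun _ hp => polyLE_rename _ hp

/-- The cyclic permutation of the variables and of the components, on vector fields. -/
noncomputable def cycField (r : ℤ) : (Fin 3 → polyLE 2 r) →ₗ[ℝ] (Fin 3 → polyLE 2 r) :=
  LinearMap.pi fun i => cycPoly r ∘ₗ LinearMap.proj ((finRotate 3).symm i)

lemma trace_cycField (r : ℤ) : LinearMap.trace ℝ _ (cycField r) = 0 :=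
  trace_pi_comp_perm_eq_zero _ (by decide) _

/-- Monomials are permuted, and the fixed ones are (x_0 x_1 x_2)^a with 3a ≤ r. Division rounds
down, so `toNat` gives 0 for every negative r. -/
lemma trace_cycPoly (r : ℤ) : LinearMap.trace ℝ _ (cycPoly r) = ((r / 3 + 1).toNat : ℝ) := by
  classical
  let S : Set (Fin 3 →₀ ℕ) := {m : Fin 3 →₀ ℕ | (m.degree : ℤ) ≤ r}
  have := Fintype.ofFinite S
  let B : Module.Basis S ℝ (polyLE 2 r) := basisRestrictSupport ℝ S
  have hrepr (p : polyLE 2 r) (d : S) :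
      B.repr p d = coeff (d : Fin 3 →₀ ℕ) (p : MvPolynomial (Fin 3) ℝ) := rfl
  have hB (d : S) : (B d : MvPolynomial (Fin 3) ℝ) = monomial (d : Fin 3 →₀ ℕ) 1 := by
    have hmem : monomial (d : Fin 3 →₀ ℕ) (1 : ℝ) ∈ polyLE 2 r :=
      (monomial_mem_restrictSupport ℝ).2 (Or.inl d.2)
    suffices B d = ⟨_, hmem⟩ by rw [this]
    apply B.repr.injective
    ext e
    rw [B.repr_self, hrepr, coeff_monomial, Finsupp.single_apply]
    simp only [Subtype.ext_iff]
  rw [LinearMap.trace_eq_matrix_trace ℝ B, Matrix.trace]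
  have hdiag (d : S) : (LinearMap.toMatrix B B (cycPoly r)).diag d
      = if (d : Fin 3 →₀ ℕ).mapDomain (finRotate 3) = d then 1 else 0 := by
    rw [Matrix.diag_apply, LinearMap.toMatrix_apply, hrepr]
    change coeff _ (rename (finRotate 3) (B d : MvPolynomial (Fin 3) ℝ)) = _
    rw [hB, rename_monomial, coeff_monomial]
  rw [Finset.sum_congr rfl fun d _ => hdiag d, Finset.sum_boole]
  congr 1
  rw [← Finset.card_range (r / 3 + 1).toNat]
  have hfix (d : Fin 3 →₀ ℕ) : d.mapDomain (finRotate 3) = d ↔ ∀ i, d i = d 0 := by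
    have hrot (i : Fin 3) : d.mapDomain (finRotate 3) (finRotate 3 i) = d i :=
      Finsupp.mapDomain_apply (finRotate 3).injective d i
    constructor
    · intro h
      rw [h] at hrot
      have h0 : d 1 = d 0 := hrot 0
      have h1 : d 2 = d 1 := hrot 1
      intro i
      fin_cases i
      exacts [rfl, h0, h1.trans h0]
    · intro h
      ext i
      obtain ⟨i, rfl⟩ := (finRotate 3).surjective i
      rw [hrot, h i, h (finRotate 3 i)]
  refine Finset.card_bij' (fun d _ => (d : Fin 3 →₀ ℕ) 0) 
    (fun a ha => ⟨Finsupp.equivFunOnFinite.symm fun _ => a, ?_⟩) ?_ ?_ ?_ ?_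
  · rw [Finset.mem_range] at ha
    simp [S, Finsupp.degree_eq_sum]
    omega
  · rintro ⟨d, hd⟩ h
    simp only [Finset.mem_filter, Finset.mem_univ, true_and, hfix] at h
    simp only [S, Set.mem_ofPred_eq, Finsupp.degree_eq_sum, h, Fin.sum_univ_three] at hd
    simp
    omega
  · intro a ha
    simp [hfix]
  · rintro ⟨d, hd⟩ h
    simp only [Finset.mem_filter, Finset.mem_univ, true_and, hfix] at h
    ext i
    simp [h i]
  · intro a ha
    simp

end CyclicPolynomials

open MvPolynomial

/-! ### Degree bounds indexed by integers -/

section DegreeBounds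

variable {n : ℕ} {m k : ℤ}

/-- The alternative p = 0 is needed because `totalDegree` of zero is 0, which exceeds a negative
bound. -/
lemma mem_polyLE_iff {p : MvPolynomial (Fin (n + 1)) ℝ} :
    p ∈ polyLE n m ↔ p = 0 ∨ (p.totalDegree : ℤ) ≤ m := by
  rw [polyLE, mem_restrictSupport_iff]
  constructor
  · intro h
    by_cases hp : p = 0
    · exact Or.inl hp
    right
    obtain ⟨d, hd⟩ := support_nonempty.2 hp
    have hm : 0 ≤ m := le_trans (by positivity) (h hd)
    obtain ⟨N, rfl⟩ := Int.eq_ofNat_of_zero_le hm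
    rw [Nat.cast_le]
    refine Finset.sup_le fun e he => ?_
    have := h he
    simp only [Set.mem_ofPred_eq, Nat.cast_le] at this
    exact this
  · rintro (rfl | h)
    · simp
    · intro d hd
      refine le_trans ?_ h
      rw [Nat.cast_le]
      exact le_totalDegree hd

lemma polyLE_mono (h : m ≤ k) : polyLE n m ≤ polyLE n k := fun p hp => by
  rw [mem_polyLE_iff] at hp ⊢
  exact hp.imp_right fun hp => hp.trans h

lemma polyLE_eq_zero (h : m < 0) {p : MvPolynomial (Fin (n + 1)) ℝ} (hp : p ∈ polyLE n m) :
    p = 0 := by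
  rcases mem_polyLE_iff.1 hp with hp | hp
  · exact hp
  · omega

lemma mul_mem_polyLE {p q : MvPolynomial (Fin (n + 1)) ℝ} (hp : p ∈ polyLE n m)
    (hq : q ∈ polyLE n k) : p * q ∈ polyLE n (m + k) := by
  rw [mem_polyLE_iff] at hp hq ⊢
  rcases hp with rfl | hp
  · simp
  rcases hq with rfl | hq
  · simp
  right
  have := totalDegree_mul p q
  omega

lemma C_mem_polyLE (h : 0 ≤ m) (c : ℝ) :
    (C c : MvPolynomial (Fin (n + 1)) ℝ) ∈ polyLE n m := by
  rw [mem_polyLE_iff, totalDegree_C]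
  exact Or.inr h

lemma X_mem_polyLE (i : Fin (n + 1)) : (X i : MvPolynomial (Fin (n + 1)) ℝ) ∈ polyLE n 1 := by
  rw [mem_polyLE_iff, totalDegree_X]
  exact Or.inr le_rfl

lemma mul_mem_polyLE_succ {p q : MvPolynomial (Fin (n + 1)) ℝ} (hq : q ∈ polyLE n 1)
    (hp : p ∈ polyLE n m) : q * p ∈ polyLE n (m + 1) := by
  rw [add_comm m]
  exact mul_mem_polyLE hq hp

lemma mem_polyLE_of_mul {p q : MvPolynomial (Fin (n + 1)) ℝ} (hq : q.totalDegree = 1)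
    (h : q * p ∈ polyLE n (m + 1)) : p ∈ polyLE n m := by
  rw [mem_polyLE_iff] at h ⊢
  by_cases hp : p = 0
  · exact Or.inl hp
  have hq0 : q ≠ 0 := by
    rintro rfl
    simp at hq
  right
  rcases h with h | h
  · exact absurd h (mul_ne_zero hq0 hp)
  · rw [totalDegree_mul_of_isDomain hq0 hp, hq] at h
    push_cast at h
    omega

lemma X_mul_mem_polyLE_iff {i : Fin (n + 1)} {p : MvPolynomial (Fin (n + 1)) ℝ} :
    X i * p ∈ polyLE n (m + 1) ↔ p ∈ polyLE n m :=
  ⟨mem_polyLE_of_mul (totalDegree_X i), mul_mem_polyLE_succ (X_mem_polyLE i)⟩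

lemma aeval_mem_polyLE {l : ℕ} {f : Fin (l + 1) → MvPolynomial (Fin (n + 1)) ℝ}
    (hf : ∀ i, f i ∈ polyLE n 1) {p : MvPolynomial (Fin (l + 1)) ℝ} (hp : p ∈ polyLE l m) :
    aeval f p ∈ polyLE n m := by
  have hpow (i : Fin (l + 1)) (a : ℕ) : f i ^ a ∈ polyLE n a := by
    induction a with
    | zero => simpa using C_mem_polyLE (n := n) le_rfl (1 : ℝ)
    | succ a ih =>
      rw [pow_succ']
      push_cast
      exact mul_mem_polyLE_succ (hf i) ih
  have hprod (d : Fin (l + 1) →₀ ℕ) (s : Finset (Fin (l + 1))) :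
      ∏ i ∈ s, f i ^ d i ∈ polyLE n (∑ i ∈ s, (d i : ℤ)) := by
    induction s using Finset.induction_on with
    | empty => simpa using C_mem_polyLE (n := n) le_rfl (1 : ℝ)
    | insert i s hi ih =>
      rw [Finset.prod_insert hi, Finset.sum_insert hi]
      exact mul_mem_polyLE (hpow i _) ih
  rw [polyLE, restrictSupport_eq_span] at hp
  induction hp using Submodule.span_induction with
  | mem x hx =>
    obtain ⟨d, hd, rfl⟩ := hx
    simp only [Set.mem_ofPred_eq, Finsupp.degree_eq_sum] at hd
    rw [aeval_monomial, map_one, one_mul, Finsupp.prod_fintype _ _ (by simp)]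
    exact polyLE_mono (by exact_mod_cast hd) (hprod d Finset.univ)
  | zero => simp
  | add x y _ _ hx hy => rw [map_add]; exact add_mem hx hy
  | smul a x _ hx => rw [map_smul]; exact Submodule.smul_mem _ _ hx

end DegreeBounds

/-! ### Divisibility by the barycentric coordinates and Koszul exactness -/

section Divisibility

/-- The substitution of `q` for the variable `X i`. -/
noncomputable def substVar (i : Fin 3) (q : MvPolynomial (Fin 3) ℝ) :
    MvPolynomial (Fin 3) ℝ →ₐ[ℝ] MvPolynomial (Fin 3) ℝ :=
  aeval (Function.update X i q)

@[simp] lemma substVar_X (i j : Fin 3) (q : MvPolynomial (Fin 3) ℝ) :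
    substVar i q (X j) = if j = i then q else X j := by
  rw [substVar, aeval_X, Function.update_apply]

lemma substVar_mem_polyLE {m : ℤ} {i : Fin 3} {q p : MvPolynomial (Fin 3) ℝ}
    (hq : q ∈ polyLE 2 1) (hp : p ∈ polyLE 2 m) : substVar i q p ∈ polyLE 2 m := by
  refine aeval_mem_polyLE (fun j => ?_) hp
  rw [Function.update_apply]
  split_ifs
  exacts [hq, X_mem_polyLE j]

/-- Modulo `X i - q` the substitution is the identity on all variables. -/
lemma dvd_sub_substVar (i : Fin 3) (q p : MvPolynomial (Fin 3) ℝ) :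
    X i - q ∣ p - substVar i q p := by
  rw [← Ideal.mem_span_singleton, ← Ideal.Quotient.eq]
  let π := Ideal.Quotient.mkₐ ℝ (Ideal.span {X i - q})
  suffices h : π = π.comp (substVar i q) from
    congrArg (fun f : MvPolynomial (Fin 3) ℝ →ₐ[ℝ] _ => f p) h
  refine algHom_ext fun j => ?_
  rw [AlgHom.comp_apply, substVar_X]
  split_ifs with h
  · subst h
    exact Ideal.Quotient.eq.2 (Ideal.mem_span_singleton_self _)
  · rfl

lemma eval_substVar (i : Fin 3) (q p : MvPolynomial (Fin 3) ℝ) (x : Fin 3 → ℝ) :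
    eval x (substVar i q p) = eval (Function.update x i (eval x q)) p := by
  let f : MvPolynomial (Fin 3) ℝ →ₐ[ℝ] ℝ := (aeval x).comp (substVar i q)
  have : f = aeval (Function.update x i (eval x q)) := by
    refine algHom_ext fun j => ?_
    rw [AlgHom.comp_apply, substVar_X, aeval_X, Function.update_apply]
    split_ifs <;> simp [aeval_eq_eval]
  have h := congrArg (fun f : MvPolynomial (Fin 3) ℝ →ₐ[ℝ] ℝ => f p) this
  simpa [f, aeval_eq_eval] using h

/-- The barycentric coordinate vanishing on the face opposite to the origin. -/
noncomputable def lam : MvPolynomial (Fin 3) ℝ := 1 - X 0 - X 1 - X 2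

lemma lam_mem_polyLE : lam ∈ polyLE 2 1 :=
  sub_mem (sub_mem (sub_mem (by simpa using C_mem_polyLE (n := 2) zero_le_one (1 : ℝ))
    (X_mem_polyLE 0)) (X_mem_polyLE 1)) (X_mem_polyLE 2)

@[simp] lemma eval_lam (x : Fin 3 → ℝ) : eval x lam = 1 - x 0 - x 1 - x 2 := by simp [lam]

@[simp] lemma constantCoeff_lam : constantCoeff lam = 1 := by simp [lam]

lemma lam_ne_zero : lam ≠ 0 := fun h => by
  simpa using congrArg constantCoeff h

lemma totalDegree_eq_one {q : MvPolynomial (Fin 3) ℝ} (hq : q ∈ polyLE 2 1) {x y : Fin 3 → ℝ}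
    (h : eval x q ≠ eval y q) : q.totalDegree = 1 := by
  refine le_antisymm ?_ (Nat.one_le_iff_ne_zero.2 fun h0 => h ?_)
  · rcases mem_polyLE_iff.1 hq with rfl | hq
    · simp
    · exact_mod_cast hq
  · rw [totalDegree_eq_zero_iff_eq_C] at h0
    rw [h0, eval_C, eval_C]

lemma totalDegree_lam : lam.totalDegree = 1 :=
  totalDegree_eq_one lam_mem_polyLE (x := ![0, 0, 0]) (y := ![1, 0, 0]) (by simp)

lemma lam_mul_mem_polyLE_iff {m : ℤ} {p : MvPolynomial (Fin 3) ℝ} :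
    lam * p ∈ polyLE 2 (m + 1) ↔ p ∈ polyLE 2 m :=
  ⟨mem_polyLE_of_mul totalDegree_lam, mul_mem_polyLE_succ lam_mem_polyLE⟩

lemma not_X_dvd_lam (i : Fin 3) : ¬ X i ∣ lam := by
  rintro ⟨c, hc⟩
  simpa using congrArg (eval (0 : Fin 3 → ℝ)) hc

/-- Primality of `X i`, which does not divide `lam`, suffices: it must divide the cofactor of `lam`
and can be cancelled. -/
lemma lam_dvd_of_dvd_X_mul {i : Fin 3} {p : MvPolynomial (Fin 3) ℝ} (h : lam ∣ X i * p) :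
    lam ∣ p := by
  obtain ⟨c, hc⟩ := h
  obtain ⟨d, rfl⟩ := ((X_prime (R := ℝ) (i := i)).dvd_or_dvd (Dvd.intro p hc)).resolve_left
    (not_X_dvd_lam i)
  exact ⟨d, mul_left_cancel₀ (X_ne_zero i) (by rw [hc]; ring)⟩

/-- The side 1/4 keeps the cube inside the simplex, and a product of infinite sets detects
polynomials. -/
lemma eq_zero_of_eval_box {p : MvPolynomial (Fin 3) ℝ}
    (h : ∀ x : Fin 3 → ℝ, (∀ i, 0 ≤ x i ∧ x i ≤ 1 / 4) → eval x p = 0) : p = 0 := by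
  refine funext_set (fun _ => Set.Icc (0 : ℝ) (1 / 4)) (fun _ => Set.Icc_infinite (by norm_num))
    fun x hx => ?_
  rw [map_zero]
  exact h x fun i => hx i (Set.mem_univ i)

lemma eq_zero_of_eval_simplex {p : MvPolynomial (Fin 3) ℝ}
    (h : ∀ x : Fin 3 → ℝ, (∀ i, 0 ≤ x i) → x 0 + x 1 + x 2 ≤ 1 → eval x p = 0) : p = 0 := by
  refine eq_zero_of_eval_box fun x hx => h x (fun i => (hx i).1) ?_
  linarith [(hx 0).2, (hx 1).2, (hx 2).2]

lemma X_dvd_of_eval_face {i : Fin 3} {p : MvPolynomial (Fin 3) ℝ}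
    (h : ∀ x : Fin 3 → ℝ, (∀ i, 0 ≤ x i) → x 0 + x 1 + x 2 ≤ 1 → x i = 0 → eval x p = 0) :
    X i ∣ p := by
  have h0 : substVar i 0 p = 0 := by
    refine eq_zero_of_eval_box fun x hx => ?_
    rw [eval_substVar, map_zero]
    have hle (j : Fin 3) : 0 ≤ Function.update x i 0 j ∧ Function.update x i 0 j ≤ 1 / 4 := by
      rw [Function.update_apply]
      split_ifs
      · norm_num
      · exact hx j
    exact h _ (fun j => (hle j).1) (by linarith [(hle 0).2, (hle 1).2, (hle 2).2]) (by simp)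
  simpa [h0] using dvd_sub_substVar i 0 p

lemma lam_dvd_of_eval_face {p : MvPolynomial (Fin 3) ℝ}
    (h : ∀ x : Fin 3 → ℝ, (∀ i, 0 ≤ x i) → x 0 + x 1 + x 2 = 1 → eval x p = 0) :
    lam ∣ p := by
  have h0 : substVar 0 (1 - X 1 - X 2) p = 0 := by
    refine eq_zero_of_eval_box fun x hx => ?_
    rw [eval_substVar]
    refine h _ (fun j => ?_) ?_
    · rw [Function.update_apply]
      split_ifs
      · simp only [map_sub, map_one, eval_X]
        linarith [(hx 1).2, (hx 2).2]
      · exact (hx j).1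
    · simp
      ring
  have := dvd_sub_substVar 0 (1 - X 1 - X 2) p
  rw [h0, sub_zero] at this
  have e : lam = -(X 0 - (1 - X 1 - X 2)) := by rw [lam]; ring
  rwa [e, neg_dvd]

lemma exists_eq_X_mul_add {m : ℤ} (i : Fin 3) {p : MvPolynomial (Fin 3) ℝ}
    (hp : p ∈ polyLE 2 (m + 1)) : ∃ a ∈ polyLE 2 m, p = X i * a + substVar i 0 p := by
  obtain ⟨a, ha⟩ := dvd_sub_substVar i 0 p
  rw [sub_zero] at ha
  refine ⟨a, (X_mul_mem_polyLE_iff (i := i)).1 ?_, by rw [← ha]; ring⟩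
  rw [← ha]
  exact sub_mem hp (substVar_mem_polyLE (zero_mem _) hp)

/-- The value of the radial field `x` paired with a vector field. -/
noncomputable def radial (u : Fin 3 → MvPolynomial (Fin 3) ℝ) : MvPolynomial (Fin 3) ℝ :=
  X 0 * u 0 + X 1 * u 1 + X 2 * u 2

lemma exists_radial_eq {m : ℤ} {p : MvPolynomial (Fin 3) ℝ} (hp : p ∈ polyLE 2 (m + 1))
    (h0 : eval 0 p = 0) : ∃ u : Fin 3 → MvPolynomial (Fin 3) ℝ,
      (∀ i, u i ∈ polyLE 2 m) ∧ radial u = p := by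
  obtain ⟨a, ha, ea⟩ := exists_eq_X_mul_add 0 hp
  have hp1 := substVar_mem_polyLE (i := 0) (zero_mem _) hp
  obtain ⟨b, hb, eb⟩ := exists_eq_X_mul_add 1 hp1
  have hp2 := substVar_mem_polyLE (i := 1) (zero_mem _) hp1
  obtain ⟨c, hc, ec⟩ := exists_eq_X_mul_add 2 hp2
  -- After splitting off multiples of the three variables one by one, only the constant term
  -- remains.
  have hz : substVar 2 0 (substVar 1 0 (substVar 0 0 p)) = 0 := by
    have e : ((substVar 2 0).comp (substVar 1 0)).comp (substVar 0 0)
        = (Algebra.ofId ℝ (MvPolynomial (Fin 3) ℝ)).comp (aeval (0 : Fin 3 → ℝ)) := by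
      refine algHom_ext fun j => ?_
      fin_cases j <;> simp
    have := congrArg (fun f : MvPolynomial (Fin 3) ℝ →ₐ[ℝ] MvPolynomial (Fin 3) ℝ => f p) e
    simp only [AlgHom.comp_apply, aeval_eq_eval, h0, map_zero] at this
    rw [this]
  refine ⟨![a, b, c], fun i => by fin_cases i <;> assumption, ?_⟩
  rw [ea, eb, ec, hz]
  simp [radial]
  ring

/-- Exactness of the Koszul complex at vector fields. -/
lemma exists_cross_eq {m : ℤ} {u : Fin 3 → MvPolynomial (Fin 3) ℝ}
    (hu : ∀ i, u i ∈ polyLE 2 (m + 1)) (h : radial u = 0) :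
    ∃ w : Fin 3 → MvPolynomial (Fin 3) ℝ, (∀ i, w i ∈ polyLE 2 m) ∧
      ∀ i, u i = w (i + 1) * X (i + 2) - w (i + 2) * X (i + 1) := by
  obtain ⟨a, ha, ea⟩ := exists_eq_X_mul_add 0 (hu 1)
  obtain ⟨b, hb, eb⟩ := exists_eq_X_mul_add 0 (hu 2)
  have h' := congrArg (substVar 0 0) h
  simp only [radial, map_add, map_mul, substVar_X, map_zero] at h'
  simp only [if_pos, zero_mul, zero_add, Fin.reduceEq, if_false] at h'
  -- On x_0 = 0 the relation reads x_1 u_1 + x_2 u_2 = 0, so there (u_1, u_2) = c (x_2, -x_1). The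
  -- first component is then forced by `radial u = 0`.
  have hd : X 2 ∣ X 1 * substVar 0 0 (u 1) :=
    ⟨-substVar 0 0 (u 2), by linear_combination h'⟩
  obtain ⟨c, hc⟩ := ((X_prime (R := ℝ) (i := (2 : Fin 3))).dvd_or_dvd hd).resolve_left
    (by rw [X_dvd_X]; decide)
  have hcm : c ∈ polyLE 2 m := by
    rw [← X_mul_mem_polyLE_iff (i := 2), ← hc]
    exact substVar_mem_polyLE (zero_mem _) (hu 1)
  have hc2 : substVar 0 0 (u 2) = -(X 1 * c) := by
    refine mul_left_cancel₀ (X_ne_zero (R := ℝ) (2 : Fin 3)) ?_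
    rw [hc] at h'
    linear_combination h'
  rw [hc] at ea
  rw [hc2] at eb
  refine ⟨![-c, -b, a], fun i => ?_, fun i => ?_⟩
  · fin_cases i
    exacts [neg_mem hcm, neg_mem hb, ha]
  · fin_cases i
    · refine mul_left_cancel₀ (X_ne_zero (R := ℝ) (0 : Fin 3)) ?_
      simp only [radial] at h
      change X 0 * u 0 = X 0 * (-b * X 2 - a * X 1)
      linear_combination h - X 1 * ea - X 2 * eb
    · change u 1 = a * X 0 - -c * X 2
      linear_combination ea
    · change u 2 = -c * X 1 - -b * X 0
      linear_combination eb

/-- A field parallel to x on the face `lam = 0` is a multiple of x modulo `lam`. On x_0 = 0 the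
first hypothesis makes v_0 a multiple c of the restriction of `lam`, namely `lam + X 0`. Hence v_0 =
x_0 (a + c) + lam c, and a + c is the factor q for every component. -/
lemma exists_eq_X_mul_add_lam_mul {m : ℤ} {v : Fin 3 → MvPolynomial (Fin 3) ℝ}
    (hv : ∀ i, v i ∈ polyLE 2 (m + 1)) (h1 : lam ∣ X 1 * v 0 - X 0 * v 1)
    (h2 : lam ∣ X 2 * v 0 - X 0 * v 2) :
    ∃ q ∈ polyLE 2 m, ∃ z : Fin 3 → MvPolynomial (Fin 3) ℝ, (∀ i, z i ∈ polyLE 2 m) ∧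
      ∀ i, v i = X i * q + lam * z i := by
  obtain ⟨g, hg⟩ := h1
  obtain ⟨a, ha, ea⟩ := exists_eq_X_mul_add 0 (hv 0)
  have hg' := congrArg (substVar 0 0) hg
  simp only [map_sub, map_mul, substVar_X] at hg'
  simp only [if_pos, zero_mul, sub_zero, Fin.reduceEq, if_false] at hg'
  have hl : substVar 0 0 lam = lam + X 0 := by
    simp [lam]
    ring
  have hnd : ¬ X 1 ∣ substVar 0 0 lam := by
    rw [hl]
    rintro ⟨c, hc⟩
    simpa using congrArg (eval (0 : Fin 3 → ℝ)) hc
  obtain ⟨c, hc⟩ :=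
    ((X_prime (R := ℝ) (i := (1 : Fin 3))).dvd_or_dvd (Dvd.intro _ hg')).resolve_left hnd
  have hc0 : substVar 0 0 (v 0) = (lam + X 0) * c := by
    refine mul_left_cancel₀ (X_ne_zero (R := ℝ) (1 : Fin 3)) ?_
    rw [hg', hc, hl]
    ring
  have hdeg : (lam + X 0).totalDegree = 1 := by
    refine totalDegree_eq_one (add_mem lam_mem_polyLE (X_mem_polyLE 0)) (x := ![0, 0, 0])
      (y := ![0, 1, 0]) (by simp)
  have hcm : c ∈ polyLE 2 m := by
    refine mem_polyLE_of_mul hdeg ?_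
    rw [← hc0]
    exact substVar_mem_polyLE (zero_mem _) (hv 0)
  have hq : a + c ∈ polyLE 2 m := add_mem ha hcm
  have key (i : Fin 3) (hi : lam ∣ X i * v 0 - X 0 * v i) : ∃ z, v i = X i * (a + c) + lam * z := by
    have hd : lam ∣ X 0 * (v i - X i * (a + c)) := by
      obtain ⟨d, hd⟩ := hi
      refine ⟨X i * c - d, ?_⟩
      rw [ea, hc0] at hd
      linear_combination -hd
    obtain ⟨z, hz⟩ := lam_dvd_of_dvd_X_mul hd
    exact ⟨z, by linear_combination hz⟩
  have key' (i : Fin 3) : ∃ z, v i = X i * (a + c) + lam * z := by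
    refine key i ?_
    fin_cases i
    exacts [by simp, ⟨g, hg⟩, h2]
  choose z hz using key'
  refine ⟨a + c, hq, z, fun i => ?_, hz⟩
  rw [← lam_mul_mem_polyLE_iff]
  have : lam * z i = v i - X i * (a + c) := by rw [hz i]; ring
  rw [this]
  exact sub_mem (hv i) (X_mul_mem_polyLE_iff.2 hq)

end Divisibility

/-! ### The rotation of vector fields, and traces on kernels and cokernels -/

/-- Polynomial vector fields in three variables, the proxies of `1`- and `2`-forms. -/
abbrev Field3 : Type := Fin 3 → MvPolynomial (Fin 3) ℝ

/-- The cyclic permutation of the variables and of the components. -/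
noncomputable def rotField : Field3 →ₗ[ℝ] Field3 :=
  LinearMap.pi fun i =>
    (rename (R := ℝ) (finRotate 3)).toLinearMap ∘ₗ LinearMap.proj ((finRotate 3).symm i)

lemma rotField_add_one (u : Field3) (i : Fin 3) :
    rotField u (i + 1) = rename (finRotate 3) (u i) := by
  have : (finRotate 3).symm (i + 1) = i := by revert i; decide
  change rename _ (u ((finRotate 3).symm (i + 1))) = _
  rw [this]

lemma cycField_add_one {m : ℤ} (z : Fin 3 → polyLE 2 m) (i : Fin 3) :
    (cycField m z (i + 1) : MvPolynomial (Fin 3) ℝ) = rename (finRotate 3) (z i).1 := by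
  have : (finRotate 3).symm (i + 1) = i := by revert i; decide
  change rename _ (z ((finRotate 3).symm (i + 1))).1 = _
  rw [this]

lemma cycField_apply_zero {m : ℤ} (z : Fin 3 → polyLE 2 m) :
    (cycField m z 0 : MvPolynomial (Fin 3) ℝ) = rename (finRotate 3) (z 2).1 :=
  cycField_add_one z 2

lemma cycField_apply_one {m : ℤ} (z : Fin 3 → polyLE 2 m) :
    (cycField m z 1 : MvPolynomial (Fin 3) ℝ) = rename (finRotate 3) (z 0).1 :=
  cycField_add_one z 0

lemma cycField_apply_two {m : ℤ} (z : Fin 3 → polyLE 2 m) :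
    (cycField m z 2 : MvPolynomial (Fin 3) ℝ) = rename (finRotate 3) (z 1).1 :=
  cycField_add_one z 1

lemma coe_cycPoly {m : ℤ} (p : polyLE 2 m) :
    (cycPoly m p : MvPolynomial (Fin 3) ℝ) = rename (finRotate 3) p.1 := rfl

lemma rename_X_rot (i : Fin 3) :
    rename (finRotate 3) (X i : MvPolynomial (Fin 3) ℝ) = X (i + 1) := by
  rw [rename_X, finRotate_apply]

lemma rename_lam : rename (finRotate 3) lam = lam := by
  simp only [lam, map_sub, map_one, rename_X_rot]
  change 1 - X 1 - X 2 - X 0 = _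
  ring

lemma field3_ext_rot {u v : Field3} (h : ∀ i, u (i + 1) = v (i + 1)) : u = v := by
  funext i
  have := h (i - 1)
  rwa [sub_add_cancel] at this

section

variable {V : Type} [AddCommGroup V] [Module ℝ V]
  {ρ : Representation ℝ (Equiv.Perm (Fin 4)) V} {W : Subrepresentation ρ} {Φ : Field3 →ₗ[ℝ] V}

lemma trace_of_injective (hΦ : ∀ u, Φ u = 0 → u = 0)
    (hrot : ∀ u, Φ (rotField u) = ρ threeCycle (Φ u)) {m : ℤ}
    (f : (Fin 3 → polyLE 2 m) →ₗ[ℝ] Field3) (hf : ∀ z, f (cycField m z) = rotField (f z))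
    (hinj : ∀ z, f z = 0 → z = 0) (hW : ∀ ω, ω ∈ W.toSubmodule ↔ ∃ z, Φ (f z) = ω) :
    FiniteDimensional ℝ W.toSubmodule ∧
    LinearMap.trace ℝ W.toSubmodule (W.toRepresentation threeCycle) = 0 := by
  rw [← trace_cycField m]
  refine trace_toRepresentation_of_injective (f := Φ ∘ₗ f) ?_
    (fun x hx => hinj _ (hΦ _ hx)) fun x => ?_
  · ext ω
    rw [hW]
    rfl
  · simp [hf, hrot]

/-- The embedding `h ↦ (-h x, ℓ h)`. -/
noncomputable def koszulShift (ℓ : MvPolynomial (Fin 3) ℝ) (hℓ : ℓ ∈ polyLE 2 1) (k : ℤ) :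
    polyLE 2 k →ₗ[ℝ] (Fin 3 → polyLE 2 (k + 1)) × polyLE 2 (k + 1) where
  toFun h := (fun i => ⟨-(X i * h.1), neg_mem (mul_mem_polyLE_succ (X_mem_polyLE i) h.2)⟩,
    ⟨ℓ * h.1, mul_mem_polyLE_succ hℓ h.2⟩)
  map_add' x y := by
    refine Prod.ext (funext fun i => Subtype.ext ?_) (Subtype.ext ?_)
    · change -(X i * (x.1 + y.1)) = -(X i * x.1) + -(X i * y.1)
      ring
    · exact mul_add ℓ x.1 y.1
  map_smul' c x := by
    refine Prod.ext (funext fun i => Subtype.ext ?_) (Subtype.ext ?_)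
    · change -(X i * (c • x.1)) = c • -(X i * x.1)
      simp
    · exact mul_smul_comm c ℓ x.1

/-- The field part contributes trace zero, leaving the number of fixed monomials of degree at most k
+ 1 minus that for degree at most k. -/
lemma trace_of_cokernel (hΦ : ∀ u, Φ u = 0 → u = 0)
    (hrot : ∀ u, Φ (rotField u) = ρ threeCycle (Φ u)) {k : ℤ} {ℓ : MvPolynomial (Fin 3) ℝ}
    (hℓ : ℓ ∈ polyLE 2 1) (hℓ0 : ℓ ≠ 0) (hℓr : rename (finRotate 3) ℓ = ℓ)
    (f : (Fin 3 → polyLE 2 (k + 1)) × polyLE 2 (k + 1) →ₗ[ℝ] Field3)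
    (hf : ∀ z q, f (cycField (k + 1) z, cycPoly (k + 1) q) = rotField (f (z, q)))
    (hker : ∀ x, f x = 0 ↔ ∃ h, koszulShift ℓ hℓ k h = x)
    (hW : ∀ ω, ω ∈ W.toSubmodule ↔ ∃ x, Φ (f x) = ω) :
    FiniteDimensional ℝ W.toSubmodule ∧
    0 ≤ LinearMap.trace ℝ W.toSubmodule (W.toRepresentation threeCycle) := by
  have := trace_toRepresentation_of_exact (W := W) (g := threeCycle) (f := Φ ∘ₗ f)
    (j := koszulShift ℓ hℓ k) (k := cycPoly k) (a := (cycField (k + 1)).prodMap (cycPoly (k + 1)))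
    (fun x y h => ?_) ?_ ?_ ?_ ?_
  · refine ⟨this.1, ?_⟩
    rw [this.2, LinearMap.trace_prodMap', trace_cycField, trace_cycPoly, trace_cycPoly, zero_add,
      sub_nonneg, Nat.cast_le]
    omega
  · have h2 := congrArg (fun x => (x.2 : MvPolynomial (Fin 3) ℝ)) h
    exact Subtype.ext (mul_left_cancel₀ hℓ0 h2)
  · ext ω
    rw [hW]
    rfl
  · intro x
    rw [← hker]
    exact ⟨hΦ _, fun h => by simp [h]⟩
  · intro y
    refine Prod.ext (funext fun i => Subtype.ext ?_) (Subtype.ext ?_)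
    · obtain ⟨i, rfl⟩ : ∃ j, i = j + 1 := ⟨i - 1, by simp⟩
      rw [LinearMap.prodMap_apply, cycField_add_one]
      simp only [koszulShift, LinearMap.coe_mk, AddHom.coe_mk, map_neg, map_mul, rename_X_rot,
        coe_cycPoly]
    · simp only [koszulShift, LinearMap.coe_mk, AddHom.coe_mk, map_mul, hℓr, coe_cycPoly,
        LinearMap.prodMap_apply]
  · rintro ⟨z, q⟩
    simp only [LinearMap.comp_apply, ← hrot, ← hf]
    rfl

/-- The map `(v, g) ↦ x · v - ℓ g`. -/
noncomputable def koszulDiff (ℓ : MvPolynomial (Fin 3) ℝ) (hℓ : ℓ ∈ polyLE 2 1) (m : ℤ) :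
    (Fin 3 → polyLE 2 m) × polyLE 2 m →ₗ[ℝ] polyLE 2 (m + 1) where
  toFun x := ⟨radial (fun i => (x.1 i).1) - ℓ * x.2.1, sub_mem
    (add_mem (add_mem (mul_mem_polyLE_succ (X_mem_polyLE 0) (x.1 0).2)
      (mul_mem_polyLE_succ (X_mem_polyLE 1) (x.1 1).2))
      (mul_mem_polyLE_succ (X_mem_polyLE 2) (x.1 2).2)) (mul_mem_polyLE_succ hℓ x.2.2)⟩
  map_add' x y := by
    ext1
    simp [radial]
    ring
  map_smul' c x := by
    ext1
    simp [radial, smul_sub]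

lemma coe_koszulDiff {ℓ : MvPolynomial (Fin 3) ℝ} (hℓ : ℓ ∈ polyLE 2 1) {m : ℤ}
    (x : (Fin 3 → polyLE 2 m) × polyLE 2 m) :
    (koszulDiff ℓ hℓ m x : MvPolynomial (Fin 3) ℝ)
      = radial (fun i => (x.1 i).1) - ℓ * x.2.1 := rfl

/-- A multiple of ℓ, whose constant term is 1, absorbs the constant term; the rest has the form x ·
u. -/
lemma koszulDiff_surjective {ℓ : MvPolynomial (Fin 3) ℝ} (hℓ : ℓ ∈ polyLE 2 1)
    (hℓ1 : constantCoeff ℓ = 1) {m : ℤ} (hm : 0 ≤ m) : Function.Surjective (koszulDiff ℓ hℓ m) := by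
  rintro ⟨p, hp⟩
  obtain ⟨u, hu, hup⟩ := exists_radial_eq (m := m) (p := p - ℓ * C (eval 0 p))
    (sub_mem hp (mul_mem_polyLE_succ hℓ (C_mem_polyLE hm _))) (by simp [hℓ1])
  refine ⟨(fun i => ⟨u i, hu i⟩, ⟨-C (eval 0 p), neg_mem (C_mem_polyLE hm _)⟩), Subtype.ext ?_⟩
  rw [coe_koszulDiff, hup]
  ring

lemma koszulDiff_rot {ℓ : MvPolynomial (Fin 3) ℝ} (hℓ : ℓ ∈ polyLE 2 1)
    (hℓr : rename (finRotate 3) ℓ = ℓ) {m : ℤ} (x : (Fin 3 → polyLE 2 m) × polyLE 2 m) :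
    koszulDiff ℓ hℓ m ((cycField m).prodMap (cycPoly m) x) =
      cycPoly (m + 1) (koszulDiff ℓ hℓ m x) := by
  apply Subtype.ext
  rw [coe_cycPoly, coe_koszulDiff, coe_koszulDiff, LinearMap.prodMap_apply]
  simp only [radial, cycField_apply_zero, cycField_apply_one, cycField_apply_two, coe_cycPoly,
    map_sub, map_add, map_mul, hℓr, rename_X_rot]
  change _ = X 1 * _ + X 2 * _ + X 0 * _ - _
  ring

/-- Since ℓ ≠ 0, the polynomial g is determined by z, so W is the kernel of `koszulDiff`. For m ≥ 0
its trace is the count of fixed monomials for degree m minus that for m + 1, hence -1 when 3 divides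
m + 1 and 0 otherwise. -/
lemma trace_of_kernel (hΦ : ∀ u, Φ u = 0 → u = 0)
    (hrot : ∀ u, Φ (rotField u) = ρ threeCycle (Φ u)) {m : ℤ} {ℓ : MvPolynomial (Fin 3) ℝ}
    (hℓ : ℓ ∈ polyLE 2 1) (hℓ1 : constantCoeff ℓ = 1) (hℓr : rename (finRotate 3) ℓ = ℓ)
    (f : (Fin 3 → polyLE 2 m) →ₗ[ℝ] Field3)
    (hf : ∀ z, f (cycField m z) = rotField (f z)) (hinj : ∀ z, f z = 0 → z = 0)
    (hW : ∀ ω, ω ∈ W.toSubmodule ↔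
      ∃ z, (∃ g ∈ polyLE 2 m, radial (fun i => (z i).1) = ℓ * g) ∧ Φ (f z) = ω) :
    FiniteDimensional ℝ W.toSubmodule ∧
    (0 ≤ LinearMap.trace ℝ W.toSubmodule (W.toRepresentation threeCycle) ↔
      ¬ (0 ≤ m ∧ (3 : ℤ) ∣ m + 1)) := by
  have hℓ0 : ℓ ≠ 0 := by
    rintro rfl
    simp at hℓ1
  let D := koszulDiff ℓ hℓ m
  let a := (cycField m).prodMap (cycPoly m)
  have ha : ∀ x ∈ LinearMap.ker D, a x ∈ LinearMap.ker D := fun x hx => by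
    rw [LinearMap.mem_ker] at hx ⊢
    rw [koszulDiff_rot hℓ hℓr, hx, map_zero]
  have hmem (x : (Fin 3 → polyLE 2 m) × polyLE 2 m) :
      x ∈ LinearMap.ker D ↔ radial (fun i => (x.1 i).1) = ℓ * x.2.1 := by
    rw [LinearMap.mem_ker, ← Subtype.coe_inj, coe_koszulDiff, Submodule.coe_zero, sub_eq_zero]
  obtain ⟨hfin, htr⟩ := trace_toRepresentation_of_injective (W := W) (g := threeCycle)
    (M := LinearMap.ker D) (f := Φ ∘ₗ f ∘ₗ LinearMap.fst ℝ _ _ ∘ₗ (LinearMap.ker D).subtype)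
    (a := a.restrict ha)
    (by
      ext ω
      rw [hW]
      constructor
      · rintro ⟨⟨x, hx⟩, rfl⟩
        exact ⟨x.1, ⟨x.2.1, x.2.2, (hmem x).1 hx⟩, rfl⟩
      · rintro ⟨z, ⟨g, hg, hzg⟩, rfl⟩
        exact ⟨⟨(z, ⟨g, hg⟩), (hmem _).2 hzg⟩, rfl⟩)
    (by
      rintro ⟨⟨z, q⟩, hx⟩ h0
      have hz : z = 0 := hinj _ (hΦ _ h0)
      subst hz
      rw [hmem] at hx
      have hq : q = 0 := by
        apply Subtype.ext
        have : ℓ * q.1 = 0 := by rw [← hx]; simp [radial]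
        exact (mul_eq_zero.1 this).resolve_left hℓ0
      subst hq
      rfl)
    (by
      rintro ⟨⟨z, q⟩, hx⟩
      simp only [LinearMap.comp_apply, ← hrot, LinearMap.fst_apply, Submodule.subtype_apply, ← hf]
      rfl)
  refine ⟨hfin, ?_⟩
  rw [htr]
  -- Negative m is separate: for m = -1 the target contains the constants and surjectivity fails,
  -- but the kernel is zero.
  rcases lt_or_ge m 0 with hm | hm
  · have : Subsingleton (polyLE 2 m) :=
      ⟨fun p q => Subtype.ext (by rw [polyLE_eq_zero hm p.2, polyLE_eq_zero hm q.2])⟩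
    have h0 : a.restrict ha = 0 := Subsingleton.elim _ _
    rw [h0, map_zero]
    simp only [le_refl, true_iff]
    omega
  · have := trace_eq_add_of_exact (K := LinearMap.ker D) (j := (LinearMap.ker D).subtype) (f := D)
      (k := a.restrict ha)
      (a := a) (b := cycPoly (m + 1)) Subtype.val_injective (koszulDiff_surjective hℓ hℓ1 hm)
      (fun x => ⟨fun h => ⟨⟨x, h⟩, rfl⟩, by rintro ⟨y, rfl⟩; exact y.2⟩) (fun _ => rfl)
      (koszulDiff_rot hℓ hℓr)
    rw [LinearMap.trace_prodMap', trace_cycField, trace_cycPoly, trace_cycPoly, zero_add] at this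
    rw [← sub_eq_iff_eq_add] at this
    rw [← this, sub_nonneg, Nat.cast_le]
    omega

end

/-! ### Fields with boundary conditions and their parametrisations -/

/-- Vector fields of degree at most `r` whose part of degree `r` is orthogonal to `x`. -/
def IsTrimmedTangential (r : ℤ) (u : Field3) : Prop :=
  (∀ i, u i ∈ polyLE 2 r) ∧ radial u ∈ polyLE 2 r

/-- Vector fields of degree at most `r` whose part of degree `r` is parallel to `x`. -/
def IsTrimmedNormal (r : ℤ) (u : Field3) : Prop :=
  ∃ w : Field3, ∃ f : MvPolynomial (Fin 3) ℝ, (∀ i, w i ∈ polyLE 2 (r - 1)) ∧ f ∈ polyLE 2 (r - 1) ∧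
    ∀ i, u i = w i + X i * f

/-- Vector fields on the simplex with vanishing tangential components on all faces. -/
def VanishesTangentially (u : Field3) : Prop :=
  (∀ i j, j ≠ i → X i ∣ u j) ∧ ∀ j, lam ∣ u 0 - u j

/-- Vector fields on the simplex with vanishing normal components on all faces. -/
def VanishesNormally (u : Field3) : Prop :=
  (∀ i, X i ∣ u i) ∧ lam ∣ u 0 + u 1 + u 2

/-- The inclusion of the vector fields of bounded degree. -/
noncomputable def fieldIncl (m : ℤ) : (Fin 3 → polyLE 2 m) →ₗ[ℝ] Field3 :=
  LinearMap.pi fun i => (polyLE 2 m).subtype ∘ₗ LinearMap.proj i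

@[simp] lemma fieldIncl_apply {m : ℤ} (z : Fin 3 → polyLE 2 m) (i : Fin 3) :
    fieldIncl m z i = z i := rfl

lemma fieldIncl_cycField {m : ℤ} (z : Fin 3 → polyLE 2 m) :
    fieldIncl m (cycField m z) = rotField (fieldIncl m z) :=
  field3_ext_rot fun i => by
    rw [rotField_add_one, fieldIncl_apply, cycField_add_one, fieldIncl_apply]

lemma fieldIncl_injective {m : ℤ} (z : Fin 3 → polyLE 2 m) (h : fieldIncl m z = 0) : z = 0 :=
  funext fun i => Subtype.ext (congrFun h i)

lemma radial_rotField (u : Field3) : radial (rotField u) = rename (finRotate 3) (radial u) := by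
  have h0 : rotField u 0 = _ := rotField_add_one u 2
  have h1 : rotField u 1 = _ := rotField_add_one u 0
  have h2 : rotField u 2 = _ := rotField_add_one u 1
  simp only [radial, map_add, map_mul, rename_X_rot, h0, h1, h2]
  change _ = X 1 * _ + X 2 * _ + X 0 * _
  ring

/-- Multiplication of the `i`-th component by `X i`. -/
noncomputable def scaleField : Field3 →ₗ[ℝ] Field3 :=
  LinearMap.pi fun i => LinearMap.mulLeft ℝ (X i) ∘ₗ LinearMap.proj i

@[simp] lemma scaleField_apply (u : Field3) (i : Fin 3) : scaleField u i = X i * u i := rfl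

lemma scaleField_rotField (u : Field3) :
    scaleField (rotField u) = rotField (scaleField u) :=
  field3_ext_rot fun i => by
    rw [rotField_add_one, scaleField_apply, scaleField_apply, rotField_add_one, map_mul,
      rename_X_rot]

lemma scaleField_injective {u : Field3} (h : scaleField u = 0) : u = 0 :=
  funext fun i => (mul_eq_zero.1 (congrFun h i)).resolve_left (X_ne_zero i)

/-- The map `y ↦ y - (x · y) (1, 1, 1)`. -/
noncomputable def subRadial : Field3 →ₗ[ℝ] Field3 where
  toFun y i := y i - radial y
  map_add' x y := by
    funext i
    simp [radial]
    ring
  map_smul' c x := by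
    funext i
    simp [radial, smul_sub]

@[simp] lemma subRadial_apply (y : Field3) (i : Fin 3) : subRadial y i = y i - radial y := rfl

lemma subRadial_rotField (u : Field3) :
    subRadial (rotField u) = rotField (subRadial u) :=
  field3_ext_rot fun i => by
    rw [rotField_add_one, subRadial_apply, subRadial_apply, rotField_add_one, map_sub,
      radial_rotField]

lemma radial_const (p : MvPolynomial (Fin 3) ℝ) : radial (fun _ => p) = p - lam * p := by
  rw [radial, lam]
  ring

lemma subRadial_injective {y : Field3} (h : subRadial y = 0) : y = 0 := by
  have hy (i : Fin 3) : y i = radial y := sub_eq_zero.1 (congrFun h i)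
  have h0 : radial y = radial y - lam * radial y := by
    conv_lhs => rw [show y = fun _ => radial y from funext hy]
    rw [radial_const]
  have h1 : lam * radial y = 0 := by linear_combination h0
  have h2 := (mul_eq_zero.1 h1).resolve_left lam_ne_zero
  funext i
  rw [hy i, h2]
  rfl

/-- The vector field with components `x_{i+1} x_{i+2} (x_i q + λ z_i)`. -/
noncomputable def bubble : Field3 × MvPolynomial (Fin 3) ℝ →ₗ[ℝ] Field3 where
  toFun x i := X (i + 1) * X (i + 2) * (X i * x.2 + lam * x.1 i)
  map_add' x y := by
    funext i
    simp
    ring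
  map_smul' c x := by
    funext i
    simp [mul_add]

lemma bubble_apply (x : Field3 × MvPolynomial (Fin 3) ℝ) (i : Fin 3) :
    bubble x i = X (i + 1) * X (i + 2) * (X i * x.2 + lam * x.1 i) := rfl

lemma bubble_rotField (z : Field3) (q : MvPolynomial (Fin 3) ℝ) :
    bubble (rotField z, rename (finRotate 3) q) = rotField (bubble (z, q)) :=
  field3_ext_rot fun i => by
    simp only [rotField_add_one, bubble_apply, map_mul, map_add, rename_X_rot, rename_lam]
    rw [add_right_comm i 2 1]

/-- The only ambiguity in x_i q + lam z_i is moving a multiple of lam x between its two summands. -/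
lemma bubble_eq_zero_iff {z : Field3} {q : MvPolynomial (Fin 3) ℝ} :
    bubble (z, q) = 0 ↔ ∃ h, q = lam * h ∧ ∀ i, z i = -(X i * h) := by
  constructor
  · intro hb
    have hi (i : Fin 3) : X i * q + lam * z i = 0 :=
      (mul_eq_zero.1 (congrFun hb i)).resolve_left (mul_ne_zero (X_ne_zero _) (X_ne_zero _))
    obtain ⟨h, rfl⟩ := lam_dvd_of_dvd_X_mul (i := 0) (p := q)
      ⟨-z 0, by linear_combination hi 0⟩
    refine ⟨h, rfl, fun i => mul_left_cancel₀ lam_ne_zero ?_⟩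
    linear_combination hi i
  · rintro ⟨h, rfl, hz⟩
    funext i
    change X (i + 1) * X (i + 2) * (X i * (lam * h) + lam * z i) = 0
    rw [hz]
    ring

lemma radial_bubble (z : Field3) (q : MvPolynomial (Fin 3) ℝ) :
    radial (bubble (z, q)) = X 0 * (X 1 * (X 2 * (q + lam * (z 0 + z 1 + z 2 - q)))) := by
  simp only [radial, bubble_apply]
  change X 0 * (X 1 * X 2 * _) + X 1 * (X 2 * X 0 * _) + X 2 * (X 0 * X 1 * _) = _
  simp only [lam]
  ring

lemma bubble_mem_polyLE {m : ℤ} {z : Field3} {q : MvPolynomial (Fin 3) ℝ}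
    (hz : ∀ i, z i ∈ polyLE 2 m) (hq : q ∈ polyLE 2 m) (i : Fin 3) :
    bubble (z, q) i ∈ polyLE 2 (m + 3) := by
  rw [bubble_apply, mul_assoc, show m + 3 = m + 1 + 1 + 1 by ring]
  exact mul_mem_polyLE_succ (X_mem_polyLE _) (mul_mem_polyLE_succ (X_mem_polyLE _)
    (add_mem (mul_mem_polyLE_succ (X_mem_polyLE _) hq)
      (mul_mem_polyLE_succ lam_mem_polyLE (hz i))))

lemma vanishesTangentially_bubble (z : Field3) (q : MvPolynomial (Fin 3) ℝ) :
    VanishesTangentially (bubble (z, q)) := by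
  constructor
  · intro i j hij
    rw [bubble_apply]
    have : i = j + 1 ∨ i = j + 2 := by revert i j; decide
    rcases this with rfl | rfl
    · exact ⟨X (j + 2) * (X j * q + lam * z j), by ring⟩
    · exact ⟨X (j + 1) * (X j * q + lam * z j), by ring⟩
  · intro j
    refine ⟨X 1 * X 2 * z 0 - X (j + 1) * X (j + 2) * z j, ?_⟩
    have : (X (j + 1) * X (j + 2) * X j : MvPolynomial (Fin 3) ℝ) = X 1 * X 2 * X 0 := by
      fin_cases j
      · rfl
      · change X 2 * X 0 * X 1 = _
        ring
      · change X 0 * X 1 * X 2 = _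
        ring
    rw [bubble_apply, bubble_apply]
    change X 1 * X 2 * _ - _ = _
    linear_combination -q * this

/-- Vanishing on the coordinate faces gives u_i = x_{i+1} x_{i+2} v_i. On the last face, u_0 - u_1 =
x_2 (x_1 v_0 - x_0 v_1) and its analogue make v parallel to x there. -/
lemma exists_bubble_eq {m : ℤ} {u : Field3} (hu : ∀ i, u i ∈ polyLE 2 (m + 3))
    (hv : VanishesTangentially u) : ∃ z : Field3, ∃ q, (∀ i, z i ∈ polyLE 2 m) ∧
      q ∈ polyLE 2 m ∧ bubble (z, q) = u := by
  have hdiv (i : Fin 3) : ∃ v, u i = X (i + 1) * (X (i + 2) * v) := by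
    have hne : i ≠ i + 1 ∧ i ≠ i + 2 ∧ i + 2 ≠ i + 1 := by revert i; decide
    obtain ⟨a, ha⟩ := hv.1 (i + 1) i hne.1
    obtain ⟨v, rfl⟩ := ((X_prime (R := ℝ) (i := i + 2)).dvd_or_dvd
      (ha ▸ hv.1 (i + 2) i hne.2.1)).resolve_left
      (by rw [X_dvd_X]; exact hne.2.2)
    exact ⟨v, ha⟩
  choose v hv' using hdiv
  have hvm (i : Fin 3) : v i ∈ polyLE 2 (m + 1) := by
    rw [← X_mul_mem_polyLE_iff (i := i + 2), ← X_mul_mem_polyLE_iff (i := i + 1), ← hv',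
      show m + 1 + 1 + 1 = m + 3 by ring]
    exact hu i
  have e0 : u 0 = X 1 * (X 2 * v 0) := hv' 0
  have e1 : u 1 = X 2 * (X 0 * v 1) := hv' 1
  have e2 : u 2 = X 0 * (X 1 * v 2) := hv' 2
  obtain ⟨q, hq, z, hz, h⟩ := exists_eq_X_mul_add_lam_mul hvm
    (lam_dvd_of_dvd_X_mul (i := 2) (by
      have := hv.2 1
      rw [e0, e1] at this
      convert this using 1
      ring))
    (lam_dvd_of_dvd_X_mul (i := 1) (by
      have := hv.2 2
      rw [e0, e2] at this
      convert this using 1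
      ring))
  refine ⟨z, q, hz, hq, funext fun i => ?_⟩
  rw [bubble_apply, hv' i, h i]
  ring

/-! ### The traces for the eight types of spaces -/

section

variable {V : Type} [AddCommGroup V] [Module ℝ V]
  {ρ : Representation ℝ (Equiv.Perm (Fin 4)) V} {W : Subrepresentation ρ} {Φ : Field3 →ₗ[ℝ] V}
  {r : ℤ}

/-- The inclusion of the pairs of a vector field and a polynomial of bounded degree. -/
noncomputable def pairIncl (m : ℤ) :
    (Fin 3 → polyLE 2 m) × polyLE 2 m →ₗ[ℝ] Field3 × MvPolynomial (Fin 3) ℝ :=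
  (fieldIncl m).prodMap (polyLE 2 m).subtype

lemma trace_full (hΦ : ∀ u, Φ u = 0 → u = 0)
    (hrot : ∀ u, Φ (rotField u) = ρ threeCycle (Φ u))
    (hW : ∀ ω, ω ∈ W.toSubmodule ↔ ∃ u, (∀ i, u i ∈ polyLE 2 r) ∧ Φ u = ω) :
    FiniteDimensional ℝ W.toSubmodule ∧
    LinearMap.trace ℝ W.toSubmodule (W.toRepresentation threeCycle) = 0 := by
  refine trace_of_injective hΦ hrot (fieldIncl r) fieldIncl_cycField fieldIncl_injective
    fun ω => ?_
  rw [hW]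
  constructor
  · rintro ⟨u, hu, rfl⟩
    exact ⟨fun i => ⟨u i, hu i⟩, rfl⟩
  · rintro ⟨z, rfl⟩
    exact ⟨_, fun i => (z i).2, rfl⟩

lemma trace_trimmedTangential (hΦ : ∀ u, Φ u = 0 → u = 0)
    (hrot : ∀ u, Φ (rotField u) = ρ threeCycle (Φ u))
    (hW : ∀ ω, ω ∈ W.toSubmodule ↔ ∃ u, IsTrimmedTangential r u ∧ Φ u = ω) :
    FiniteDimensional ℝ W.toSubmodule ∧
    (0 ≤ LinearMap.trace ℝ W.toSubmodule (W.toRepresentation threeCycle) ↔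
      ¬ (0 ≤ r ∧ (3 : ℤ) ∣ r + 1)) := by
  refine trace_of_kernel hΦ hrot (ℓ := 1) (by simpa using C_mem_polyLE (n := 2) zero_le_one (1 : ℝ))
    (map_one _) (map_one _) (fieldIncl r) fieldIncl_cycField fieldIncl_injective fun ω => ?_
  rw [hW]
  constructor
  · rintro ⟨u, ⟨hu, hr⟩, rfl⟩
    exact ⟨fun i => ⟨u i, hu i⟩, ⟨_, hr, (one_mul _).symm⟩, rfl⟩
  · rintro ⟨z, ⟨g, hg, hzg⟩, rfl⟩
    refine ⟨_, ⟨fun i => (z i).2, ?_⟩, rfl⟩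
    rw [one_mul] at hzg
    exact hzg ▸ hg

lemma trace_trimmedNormal (hΦ : ∀ u, Φ u = 0 → u = 0)
    (hrot : ∀ u, Φ (rotField u) = ρ threeCycle (Φ u))
    (hW : ∀ ω, ω ∈ W.toSubmodule ↔ ∃ u, IsTrimmedNormal r u ∧ Φ u = ω) :
    FiniteDimensional ℝ W.toSubmodule ∧
    0 ≤ LinearMap.trace ℝ W.toSubmodule (W.toRepresentation threeCycle) := by
  -- The pair (w, f) has degree r - 1, and w + x f = 0 forces w = -f x, which leaves degree r - 2
  -- for f.
  obtain ⟨k, rfl⟩ : ∃ k, r = k + 1 + 1 := ⟨r - 2, by ring⟩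
  let f : Field3 × MvPolynomial (Fin 3) ℝ →ₗ[ℝ] Field3 :=
    LinearMap.fst ℝ _ _ + LinearMap.pi fun i => LinearMap.mulLeft ℝ (X i) ∘ₗ LinearMap.snd ℝ _ _
  have hf (w : Field3) (q : MvPolynomial (Fin 3) ℝ) (i : Fin 3) : f (w, q) i = w i + X i * q := rfl
  refine trace_of_cokernel hΦ hrot (k := k) (ℓ := 1)
    (by simpa using C_mem_polyLE (n := 2) zero_le_one (1 : ℝ)) one_ne_zero (map_one _)
    (f ∘ₗ pairIncl (k + 1)) (fun z q => ?_) (fun x => ?_) fun ω => ?_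
  · change f (fieldIncl _ (cycField _ z), rename (finRotate 3) q.1)
      = rotField (f (fieldIncl _ z, q.1))
    rw [fieldIncl_cycField]
    refine field3_ext_rot fun i => ?_
    rw [rotField_add_one, hf, hf, rotField_add_one, map_add, map_mul, rename_X_rot]
  · constructor
    · intro h
      have hi (i : Fin 3) : (x.1 i).1 + X i * x.2.1 = 0 := congrFun h i
      have hm : x.2.1 ∈ polyLE 2 k := by
        rw [← X_mul_mem_polyLE_iff (i := 0), ← neg_mem_iff, ← eq_neg_of_add_eq_zero_left (hi 0)]
        exact (x.1 0).2
      refine ⟨⟨x.2.1, hm⟩, Prod.ext (funext fun i => Subtype.ext ?_) (Subtype.ext (one_mul _))⟩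
      exact (eq_neg_of_add_eq_zero_left (hi i)).symm
    · rintro ⟨h, rfl⟩
      funext i
      change -(X i * h.1) + X i * (1 * h.1) = 0
      ring
  · rw [hW]
    simp only [IsTrimmedNormal, add_sub_cancel_right]
    constructor
    · rintro ⟨u, ⟨w, q, hw, hq, hu⟩, rfl⟩
      refine ⟨(fun i => ⟨w i, hw i⟩, ⟨q, hq⟩), congrArg Φ (funext fun i => (hu i).symm)⟩
    · rintro ⟨x, rfl⟩
      exact ⟨_, ⟨_, _, fun i => (x.1 i).2, x.2.2, fun i => rfl⟩, rfl⟩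

lemma trace_fullTangential₀ (hΦ : ∀ u, Φ u = 0 → u = 0)
    (hrot : ∀ u, Φ (rotField u) = ρ threeCycle (Φ u))
    (hW : ∀ ω, ω ∈ W.toSubmodule ↔
      ∃ u, ((∀ i, u i ∈ polyLE 2 r) ∧ VanishesTangentially u) ∧ Φ u = ω) :
    FiniteDimensional ℝ W.toSubmodule ∧
    0 ≤ LinearMap.trace ℝ W.toSubmodule (W.toRepresentation threeCycle) := by
  obtain ⟨k, rfl⟩ : ∃ k, r = k + 1 + 3 := ⟨r - 4, by ring⟩
  refine trace_of_cokernel hΦ hrot (k := k) lam_mem_polyLE lam_ne_zero rename_lam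
    (bubble ∘ₗ pairIncl (k + 1)) (fun z q => ?_) (fun x => ?_) fun ω => ?_
  · change bubble (fieldIncl _ (cycField _ z), rename (finRotate 3) q.1)
      = rotField (bubble (fieldIncl _ z, q.1))
    rw [fieldIncl_cycField, bubble_rotField]
  · change bubble (fieldIncl _ x.1, x.2.1) = 0 ↔ _
    rw [bubble_eq_zero_iff]
    constructor
    · rintro ⟨h, hq, hz⟩
      have hm : h ∈ polyLE 2 k := by
        rw [← lam_mul_mem_polyLE_iff, ← hq]
        exact x.2.2
      exact ⟨⟨h, hm⟩, Prod.ext (funext fun i => Subtype.ext (hz i).symm) (Subtype.ext hq.symm)⟩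
    · rintro ⟨h, rfl⟩
      exact ⟨h.1, rfl, fun i => rfl⟩
  · rw [hW]
    constructor
    · rintro ⟨u, ⟨hu, hv⟩, rfl⟩
      obtain ⟨z, q, hz, hq, rfl⟩ := exists_bubble_eq hu hv
      exact ⟨(fun i => ⟨z i, hz i⟩, ⟨q, hq⟩), rfl⟩
    · rintro ⟨x, rfl⟩
      exact ⟨_, ⟨bubble_mem_polyLE (fun i => (x.1 i).2) x.2.2, vanishesTangentially_bubble _ _⟩,
        rfl⟩

lemma trace_trimmedTangential₀ (hΦ : ∀ u, Φ u = 0 → u = 0)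
    (hrot : ∀ u, Φ (rotField u) = ρ threeCycle (Φ u))
    (hW : ∀ ω, ω ∈ W.toSubmodule ↔
      ∃ u, (IsTrimmedTangential r u ∧ VanishesTangentially u) ∧ Φ u = ω) :
    FiniteDimensional ℝ W.toSubmodule ∧
    LinearMap.trace ℝ W.toSubmodule (W.toRepresentation threeCycle) = 0 := by
  obtain ⟨m, rfl⟩ : ∃ m, r = m + 3 := ⟨r - 3, by ring⟩
  let π (i : Fin 3) : Field3 →ₗ[ℝ] MvPolynomial (Fin 3) ℝ := LinearMap.proj i
  let s : Field3 →ₗ[ℝ] Field3 × MvPolynomial (Fin 3) ℝ :=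
    -- The degree condition on x · u bounds z_0 + z_1 + z_2 - q by degree m - 1. The ambiguity of
    -- `bubble` then allows normalising q to equal z_0 + z_1 + z_2, which makes z unique.
    LinearMap.id.prod (π 0 + π 1 + π 2)
  have hs (z : Field3) : s z = (z, z 0 + z 1 + z 2) := rfl
  refine trace_of_injective hΦ hrot (bubble ∘ₗ s ∘ₗ fieldIncl m) (fun z => ?_) (fun z hz => ?_)
    fun ω => ?_
  · simp only [LinearMap.comp_apply, hs, fieldIncl_cycField, ← bubble_rotField, map_add]
    congr 2
    simp only [← rotField_add_one]
    change _ = rotField _ 1 + rotField _ 2 + rotField _ 0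
    ring
  · obtain ⟨h, hq, hi⟩ := bubble_eq_zero_iff.1 hz
    have hh : h = 0 := by
      change (z 0).1 + (z 1).1 + (z 2).1 = _ at hq
      have h0 : (z 0).1 = _ := hi 0
      have h1 : (z 1).1 = _ := hi 1
      have h2 : (z 2).1 = _ := hi 2
      rw [h0, h1, h2, lam] at hq
      linear_combination -hq
    refine fieldIncl_injective _ (funext fun i => ?_)
    rw [LinearMap.id_apply] at hi
    rw [hi i, hh, mul_zero, neg_zero]
    rfl
  · rw [hW]
    constructor
    · rintro ⟨u, ⟨⟨hu, hr⟩, hv⟩, rfl⟩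
      obtain ⟨z, q, hz, hq, rfl⟩ := exists_bubble_eq hu hv
      rw [radial_bubble, show m + 3 = m + 1 + 1 + 1 by ring, X_mul_mem_polyLE_iff,
        X_mul_mem_polyLE_iff, X_mul_mem_polyLE_iff] at hr
      have hh : z 0 + z 1 + z 2 - q ∈ polyLE 2 (m - 1) := by
        rw [← lam_mul_mem_polyLE_iff, sub_add_cancel]
        convert sub_mem hr hq using 1
        ring
      -- With h = z_0 + z_1 + z_2 - q, passing to (z - h x, q + lam h) keeps the field, and the new
      -- components sum to the new q since x_0 + x_1 + x_2 = 1 - lam.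
      refine ⟨fun i => ⟨z i - X i * (z 0 + z 1 + z 2 - q), sub_mem (hz i) ?_⟩, congrArg Φ ?_⟩
      · rw [← sub_add_cancel m 1, X_mul_mem_polyLE_iff]
        exact hh
      · funext i
        simp only [LinearMap.comp_apply, hs, bubble_apply, fieldIncl_apply, lam]
        ring
    · rintro ⟨z, rfl⟩
      have hsum : (z 0).1 + (z 1).1 + (z 2).1 ∈ polyLE 2 m :=
        add_mem (add_mem (z 0).2 (z 1).2) (z 2).2
      refine ⟨_, ⟨⟨bubble_mem_polyLE (fun i => (z i).2) hsum, ?_⟩,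
        vanishesTangentially_bubble _ _⟩, rfl⟩
      rw [radial_bubble, show m + 3 = m + 1 + 1 + 1 by ring, X_mul_mem_polyLE_iff,
        X_mul_mem_polyLE_iff, X_mul_mem_polyLE_iff]
      simpa using hsum

lemma trace_fullNormal₀ (hΦ : ∀ u, Φ u = 0 → u = 0)
    (hrot : ∀ u, Φ (rotField u) = ρ threeCycle (Φ u))
    (hW : ∀ ω, ω ∈ W.toSubmodule ↔
      ∃ u, ((∀ i, u i ∈ polyLE 2 r) ∧ VanishesNormally u) ∧ Φ u = ω) :
    FiniteDimensional ℝ W.toSubmodule ∧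
    (0 ≤ LinearMap.trace ℝ W.toSubmodule (W.toRepresentation threeCycle) ↔
      ¬ (0 ≤ r - 1 ∧ (3 : ℤ) ∣ r)) := by
  obtain ⟨m, rfl⟩ : ∃ m, r = m + 1 := ⟨r - 1, by ring⟩
  rw [add_sub_cancel_right]
  refine trace_of_kernel hΦ hrot lam_mem_polyLE constantCoeff_lam rename_lam
    (scaleField ∘ₗ fieldIncl m) (fun z => ?_)
    (fun z hz => fieldIncl_injective _ (scaleField_injective hz)) fun ω => ?_
  · rw [LinearMap.comp_apply, fieldIncl_cycField, scaleField_rotField]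
    rfl
  · rw [hW]
    constructor
    · rintro ⟨u, ⟨hu, hv, g, hg⟩, rfl⟩
      choose v hv' using hv
      have hvm (i : Fin 3) : v i ∈ polyLE 2 m := by
        rw [← X_mul_mem_polyLE_iff (i := i), ← hv' i]
        exact hu i
      refine ⟨fun i => ⟨v i, hvm i⟩, ⟨g, ?_, ?_⟩, congrArg Φ (funext fun i => (hv' i).symm)⟩
      · rw [← lam_mul_mem_polyLE_iff, ← hg]
        exact add_mem (add_mem (hu 0) (hu 1)) (hu 2)
      · rw [← hg, hv' 0, hv' 1, hv' 2]
        rfl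
    · rintro ⟨z, ⟨g, -, hzg⟩, rfl⟩
      refine ⟨_, ⟨fun i => X_mul_mem_polyLE_iff.2 (z i).2, fun i => ⟨_, rfl⟩, g, hzg⟩, rfl⟩

lemma trace_trimmedNormal₀ (hΦ : ∀ u, Φ u = 0 → u = 0)
    (hrot : ∀ u, Φ (rotField u) = ρ threeCycle (Φ u))
    (hW : ∀ ω, ω ∈ W.toSubmodule ↔
      ∃ u, (IsTrimmedNormal r u ∧ VanishesNormally u) ∧ Φ u = ω) :
    FiniteDimensional ℝ W.toSubmodule ∧
    LinearMap.trace ℝ W.toSubmodule (W.toRepresentation threeCycle) = 0 := by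
  obtain ⟨m, rfl⟩ : ∃ m, r = m + 1 + 1 := ⟨r - 2, by ring⟩
  refine trace_of_injective hΦ hrot (scaleField ∘ₗ subRadial ∘ₗ fieldIncl m) (fun z => ?_)
    (fun z hz => fieldIncl_injective _ (subRadial_injective (scaleField_injective hz)))
    fun ω => ?_
  · simp only [LinearMap.comp_apply]
    rw [fieldIncl_cycField, subRadial_rotField, scaleField_rotField]
  · rw [hW]
    simp only [IsTrimmedNormal, add_sub_cancel_right]
    constructor
    · rintro ⟨u, ⟨⟨w, f, hw, hf, hu⟩, hv, hl⟩, rfl⟩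
      have hy (i : Fin 3) : X i ∣ w i := by
        have : w i = u i - X i * f := by rw [hu i]; ring
        rw [this]
        exact dvd_sub (hv i) (dvd_mul_right _ _)
      choose y hy using hy
      have hym (i : Fin 3) : y i ∈ polyLE 2 m := by
        rw [← X_mul_mem_polyLE_iff (i := i), ← hy i]
        exact hw i
      have hrm : radial y ∈ polyLE 2 (m + 1) := by
        rw [radial, ← hy, ← hy, ← hy]
        exact add_mem (add_mem (hw 0) (hw 1)) (hw 2)
      -- Modulo lam the component sum of u is x · y + f. With g the quotient, z = y + g (1, 1, 1)
      -- satisfies z_i - x · z = y_i + f.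
      obtain ⟨g, hg⟩ : lam ∣ f + radial y := by
        obtain ⟨d, hd⟩ := hl
        rw [hu 0, hu 1, hu 2, hy 0, hy 1, hy 2] at hd
        refine ⟨d + f, ?_⟩
        rw [mul_add, ← hd, radial, lam]
        ring
      have hgm : g ∈ polyLE 2 m := by
        rw [← lam_mul_mem_polyLE_iff, ← hg]
        exact add_mem hf hrm
      refine ⟨fun i => ⟨y i + g, add_mem (hym i) hgm⟩, congrArg Φ (funext fun i => ?_)⟩
      simp only [LinearMap.comp_apply, scaleField_apply, subRadial_apply, fieldIncl_apply]
      rw [hu i, hy i]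
      simp only [radial, fieldIncl_apply, lam] at hg ⊢
      linear_combination (-X i) * hg
    · rintro ⟨z, rfl⟩
      have hrm : radial (fieldIncl m z) ∈ polyLE 2 (m + 1) :=
        add_mem (add_mem (X_mul_mem_polyLE_iff.2 (z 0).2) (X_mul_mem_polyLE_iff.2 (z 1).2))
          (X_mul_mem_polyLE_iff.2 (z 2).2)
      refine ⟨_, ⟨⟨fun i => X i * (z i).1, -radial (fieldIncl m z),
        fun i => X_mul_mem_polyLE_iff.2 (z i).2, neg_mem hrm, fun i => ?_⟩, fun i => ⟨_, rfl⟩,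
        radial (fieldIncl m z), ?_⟩, rfl⟩
      · change X i * ((z i).1 - radial (fieldIncl m z))
          = X i * (z i).1 + X i * -radial (fieldIncl m z)
        ring
      · change X 0 * ((z 0).1 - radial (fieldIncl m z)) + X 1 * ((z 1).1 - radial (fieldIncl m z))
          + X 2 * ((z 2).1 - radial (fieldIncl m z)) = lam * radial (fieldIncl m z)
        simp only [radial, fieldIncl_apply, lam]
        ring

end

/-! ### Three affine coordinates on the tetrahedron -/

section SimplexCoordinates

/-- The first three barycentric coordinates. -/
def coords (x : Simplex 3) : Fin 3 → ℝ := fun i => (x : Vec 3) i.castSucc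

lemma simplex_sum (x : Simplex 3) :
    (x : Vec 3) 3 = 1 - coords x 0 - coords x 1 - coords x 2 := by
  have : ∑ i, (x : Vec 3) i = 1 := x.2.2
  rw [Fin.sum_univ_four] at this
  change (x : Vec 3) 3 = 1 - (x : Vec 3) 0 - (x : Vec 3) 1 - (x : Vec 3) 2
  linarith

/-- The point of the tetrahedron with given first three barycentric coordinates. -/
def simplexPoint (x : Fin 3 → ℝ) (h0 : ∀ i, 0 ≤ x i) (h1 : x 0 + x 1 + x 2 ≤ 1) : Simplex 3 :=
  ⟨![x 0, x 1, x 2, 1 - x 0 - x 1 - x 2], by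
    refine ⟨fun i => ?_, ?_⟩
    · fin_cases i
      exacts [h0 0, h0 1, h0 2, by change 0 ≤ 1 - x 0 - x 1 - x 2; linarith]
    · rw [Fin.sum_univ_four]
      change x 0 + x 1 + x 2 + (1 - x 0 - x 1 - x 2) = 1
      ring⟩

@[simp] lemma coords_simplexPoint (x : Fin 3 → ℝ) (h0 : ∀ i, 0 ≤ x i)
    (h1 : x 0 + x 1 + x 2 ≤ 1) : coords (simplexPoint x h0 h1) = x := by
  funext i
  fin_cases i <;> rfl

lemma eq_zero_of_eval_coords {p : MvPolynomial (Fin 3) ℝ}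
    (h : ∀ x : Simplex 3, eval (coords x) p = 0) : p = 0 :=
  eq_zero_of_eval_simplex fun x h0 h1 => by simpa using h (simplexPoint x h0 h1)

lemma X_dvd_of_eval_coords {i : Fin 3} {p : MvPolynomial (Fin 3) ℝ}
    (h : ∀ x : Simplex 3, (x : Vec 3) i.castSucc = 0 → eval (coords x) p = 0) : X i ∣ p :=
  X_dvd_of_eval_face fun x h0 h1 hi => by
    have := h (simplexPoint x h0 h1)
    rw [coords_simplexPoint] at this
    exact this ((congrFun (coords_simplexPoint x h0 h1) i).trans hi)

lemma lam_dvd_of_eval_coords {p : MvPolynomial (Fin 3) ℝ}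
    (h : ∀ x : Simplex 3, (x : Vec 3) 3 = 0 → eval (coords x) p = 0) : lam ∣ p :=
  lam_dvd_of_eval_face fun x h0 h1 => by
    have := h (simplexPoint x h0 h1.le)
    rw [coords_simplexPoint, simplex_sum, coords_simplexPoint] at this
    exact this (by linarith)

/-- The first three components of a tangent vector determine it. -/
def tangentEquiv : tangent 3 ≃ₗ[ℝ] (Fin 3 → ℝ) where
  toFun v i := (v : Vec 3) i.castSucc
  map_add' _ _ := rfl
  map_smul' _ _ := rfl
  invFun c := ⟨![c 0, c 1, c 2, -c 0 - c 1 - c 2], by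
    change ∑ i, _ = (0 : ℝ)
    rw [Fin.sum_univ_four]
    change c 0 + c 1 + c 2 + (-c 0 - c 1 - c 2) = 0
    ring⟩
  left_inv v := by
    have h : ∑ i, (v : Vec 3) i = 0 := v.2
    rw [Fin.sum_univ_four] at h
    ext i
    fin_cases i
    · rfl
    · rfl
    · rfl
    · change -(v : Vec 3) 0 - (v : Vec 3) 1 - (v : Vec 3) 2 = (v : Vec 3) 3
      linarith
  right_inv c := by
    funext i
    fin_cases i <;> rfl

lemma tangent_three (v : tangent 3) :
    (v : Vec 3) 3 = -(v : Vec 3) 0 - (v : Vec 3) 1 - (v : Vec 3) 2 := by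
  have h : ∑ i, (v : Vec 3) i = 0 := v.2
  rw [Fin.sum_univ_four] at h
  linarith

/-- The basis of the tangent space consisting of the edges starting in the last vertex. -/
noncomputable def edgeBasis : Module.Basis (Fin 3) ℝ (tangent 3) := .ofEquivFun tangentEquiv

/-- The edges of the tetrahedron starting in the last vertex. -/
noncomputable def edge (i : Fin 3) : tangent 3 := edgeBasis i

lemma edge_castSucc (i j : Fin 3) :
    (edge i : Vec 3) j.castSucc = if j = i then 1 else 0 := by
  have h : tangentEquiv (edge i) = Pi.single i 1 := by
    rw [edge, edgeBasis, Module.Basis.coe_ofEquivFun, LinearEquiv.apply_symm_apply]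
  exact (congrFun h j).trans (Pi.single_apply _ _ _)

/-- The restriction to the tetrahedron of a polynomial in the barycentric coordinates. -/
noncomputable def restrictPoly : MvPolynomial (Fin 4) ℝ →ₐ[ℝ] MvPolynomial (Fin 3) ℝ :=
  aeval ![X 0, X 1, X 2, lam]

lemma restrictPoly_mem {r : ℤ} {p : MvPolynomial (Fin 4) ℝ} (hp : p ∈ polyLE 3 r) :
    restrictPoly p ∈ polyLE 2 r :=
  aeval_mem_polyLE (fun i => by
    fin_cases i
    exacts [X_mem_polyLE _, X_mem_polyLE _, X_mem_polyLE _, lam_mem_polyLE]) hp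

lemma eval_restrictPoly (p : MvPolynomial (Fin 4) ℝ) (x : Simplex 3) :
    eval (coords x) (restrictPoly p) = eval (x : Vec 3) p := by
  have h : (aeval (coords x)).comp restrictPoly = aeval (x : Vec 3) := by
    refine algHom_ext fun i => ?_
    rw [AlgHom.comp_apply, restrictPoly, aeval_X, aeval_X]
    fin_cases i
    · exact aeval_X _ _
    · exact aeval_X _ _
    · exact aeval_X _ _
    · rw [aeval_eq_eval]
      exact (eval_lam _).trans (simplex_sum x).symm
  have := congrArg (fun f : MvPolynomial (Fin 4) ℝ →ₐ[ℝ] ℝ => f p) h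
  simpa [aeval_eq_eval] using this

lemma rename_castSucc_mem {r : ℤ} {p : MvPolynomial (Fin 3) ℝ} (hp : p ∈ polyLE 2 r) :
    rename Fin.castSucc p ∈ polyLE 3 r := by
  rw [mem_polyLE_iff] at hp ⊢
  rcases hp with rfl | hp
  · simp
  · have := totalDegree_rename_le (Fin.castSucc : Fin 3 → Fin 4) p
    right
    omega

lemma eval_rename_castSucc (p : MvPolynomial (Fin 3) ℝ) (x : Simplex 3) :
    eval (x : Vec 3) (rename Fin.castSucc p) = eval (coords x) p := by
  rw [eval_rename]
  rfl

end SimplexCoordinates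

/-! ### Forms as vector fields -/

section Frames

lemma alternatingMap_sum_apply {ι κ M : Type} [AddCommGroup M] [Module ℝ M] (s : Finset κ)
    (f : κ → M [⋀^ι]→ₗ[ℝ] ℝ) (v : ι → M) : (∑ i ∈ s, f i) v = ∑ i ∈ s, f i v := by
  classical
  induction s using Finset.induction_on with
  | empty => simp
  | insert i s hi ih =>
    rw [Finset.sum_insert hi, Finset.sum_insert hi, AlternatingMap.add_apply, ih]

/-- A frame of constant `k`-forms with a dual family of `k`-tuples of tangent vectors, compatible
with the rotation of the first three coordinates. -/
structure FormFrame (k : ℕ) where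
  /-- The constant forms. -/
  form : Fin 3 → Vec 3 [⋀^Fin k]→ₗ[ℝ] ℝ
  /-- The dual tuples of vectors. -/
  vec : Fin 3 → Fin k → tangent 3
  form_vec (i j : Fin 3) : form i (fun l => vec j l) = if i = j then 1 else 0
  expand (ω : tangent 3 [⋀^Fin k]→ₗ[ℝ] ℝ) :
    ω = ∑ i, ω (vec i) • (form i).compLinearMap (tangent 3).subtype
  form_perm (i : Fin 3) (v : Fin k → Vec 3) :
    form i (fun l => permVec 3 threeCycle (v l)) = form (i + 1) v

namespace FormFrame

variable {k : ℕ} (F : FormFrame k) {r : ℤ}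

/-- The form with given proxy field. -/
noncomputable def toForm : Field3 →ₗ[ℝ] SimplexForm 3 k where
  toFun u x := ∑ i, eval (coords x) (u i) • (F.form i).compLinearMap (tangent 3).subtype
  map_add' u v := by
    funext x
    simp [add_smul, Finset.sum_add_distrib]
  map_smul' c u := by
    funext x
    simp [Finset.smul_sum, mul_smul]

lemma toForm_apply (u : Field3) (x : Simplex 3) (v : Fin k → tangent 3) :
    F.toForm u x v = ∑ i, eval (coords x) (u i) * F.form i (fun l => v l) := by
  change (∑ i, eval (coords x) (u i) • (F.form i).compLinearMap (tangent 3).subtype) v = _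
  rw [alternatingMap_sum_apply]
  rfl

lemma toForm_vec (u : Field3) (x : Simplex 3) (i : Fin 3) :
    F.toForm u x (F.vec i) = eval (coords x) (u i) := by
  rw [toForm_apply]
  simp [F.form_vec]

lemma toForm_injective (u : Field3) (h : F.toForm u = 0) : u = 0 := by
  funext i
  refine eq_zero_of_eval_coords fun x => ?_
  rw [← F.toForm_vec, h]
  rfl

lemma eq_toForm {ω : SimplexForm 3 k} {u : Field3}
    (h : ∀ x i, ω x (F.vec i) = eval (coords x) (u i)) : ω = F.toForm u := by
  funext x
  rw [F.expand (ω x)]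
  simp only [h]
  rfl

lemma toForm_rotField (u : Field3) :
    F.toForm (rotField u) = simplexRep 3 k threeCycle (F.toForm u) := by
  funext x
  ext v
  change _ = F.toForm u (permSimplex 3 threeCycle x) (fun l => permTangent 3 threeCycle (v l))
  have hc : coords (permSimplex 3 threeCycle x) = coords x ∘ finRotate 3 := by
    funext i
    change (x : Vec 3) (threeCycle i.castSucc) = (x : Vec 3) (finRotate 3 i).castSucc
    congr 1
    revert i
    decide
  rw [toForm_apply, toForm_apply, ← Equiv.sum_comp (Equiv.addRight (1 : Fin 3))]
  refine Finset.sum_congr rfl fun i _ => ?_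
  rw [Equiv.coe_addRight, rotField_add_one, eval_rename, hc, ← F.form_perm]
  rfl

lemma mem_polyForms (ω : SimplexForm 3 k) : ω ∈ (polyForms 3 r k).toSubmodule ↔
    ∃ u : Field3, (∀ i, u i ∈ polyLE 2 r) ∧ F.toForm u = ω := by
  constructor
  · rintro ⟨α, hα, rfl⟩
    choose p hp hp' using fun i => hα (fun l => (F.vec i l : Vec 3))
    refine ⟨fun i => restrictPoly (p i), fun i => restrictPoly_mem (hp i), Eq.symm ?_⟩
    refine F.eq_toForm fun x i => ?_
    rw [eval_restrictPoly]
    exact hp' i x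
  · rintro ⟨u, hu, rfl⟩
    -- The ambient extension has coefficients independent of λ_3, so the degree bound is kept.
    refine ⟨fun x => ∑ i, eval x (rename Fin.castSucc (u i)) • F.form i, fun v => ?_, ?_⟩
    · refine ⟨∑ i, F.form i v • rename Fin.castSucc (u i),
        sum_mem fun i _ => Submodule.smul_mem _ _ (rename_castSucc_mem (hu i)), fun x => ?_⟩
      simp [alternatingMap_sum_apply, mul_comm]
    · funext x
      ext v
      rw [toForm_apply]
      change (∑ i, eval (x : Vec 3) (rename Fin.castSucc (u i)) • F.form i) (fun l => v l) = _
      simp [alternatingMap_sum_apply, eval_rename_castSucc]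

end FormFrame

lemma mem_vanishingTrace {k : ℕ} (ω : SimplexForm 3 k) :
    ω ∈ (vanishingTrace 3 k).toSubmodule ↔ ∀ (i : Fin 4) (x : Simplex 3), (x : Vec 3) i = 0 →
      ∀ v : Fin k → tangent 3, (∀ l, (v l : Vec 3) i = 0) → ω x v = 0 := by
  simp only [vanishingTrace, Submodule.mem_iInf, LinearMap.mem_ker]
  constructor
  · intro h i x hx v hv
    exact congrArg (fun η => η fun l => ⟨v l, hv l⟩) (congrFun (h i) ⟨x, hx⟩)
  · intro h i
    funext x
    ext v
    exact h i x x.2 (fun l => v l) fun l => (v l).2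

/-- The constant form given by the determinant of `k` linear functionals. -/
noncomputable def detForm {k : ℕ} (L : Fin k → Vec 3 →ₗ[ℝ] ℝ) : Vec 3 [⋀^Fin k]→ₗ[ℝ] ℝ :=
  Matrix.detRowAlternating.compLinearMap (LinearMap.pi L)

lemma detForm_apply {k : ℕ} (L : Fin k → Vec 3 →ₗ[ℝ] ℝ) (v : Fin k → Vec 3) :
    detForm L v = Matrix.det (Matrix.of fun i j => L j (v i)) := rfl

/-- The first three coordinate functionals. -/
def coordFun (i : Fin 3) : Vec 3 →ₗ[ℝ] ℝ := LinearMap.proj i.castSucc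

@[simp] lemma coordFun_apply (i : Fin 3) (v : Vec 3) : coordFun i v = v i.castSucc := rfl

lemma permVec_threeCycle (v : Vec 3) (i : Fin 3) :
    permVec 3 threeCycle v i.castSucc = v (i + 1).castSucc := by
  rw [permVec_apply]
  congr 1
  revert i
  decide

lemma detForm_one (a : Vec 3 →ₗ[ℝ] ℝ) (v : Fin 1 → Vec 3) : detForm ![a] v = a (v 0) := by
  rw [detForm_apply, Matrix.det_fin_one]
  rfl

lemma detForm_two (a b : Vec 3 →ₗ[ℝ] ℝ) (v : Fin 2 → Vec 3) :
    detForm ![a, b] v = a (v 0) * b (v 1) - b (v 0) * a (v 1) := by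
  rw [detForm_apply, Matrix.det_fin_two]
  rfl

lemma detForm_three (a b c : Vec 3 →ₗ[ℝ] ℝ) (v : Fin 3 → Vec 3) :
    detForm ![a, b, c] v = a (v 0) * b (v 1) * c (v 2) - a (v 0) * c (v 1) * b (v 2)
      - b (v 0) * a (v 1) * c (v 2) + b (v 0) * c (v 1) * a (v 2)
      + c (v 0) * a (v 1) * b (v 2) - c (v 0) * b (v 1) * a (v 2) := by
  rw [detForm_apply, Matrix.det_fin_three]
  rfl

/-- The frame `dλ_0, dλ_1, dλ_2` of `1`-forms. -/
noncomputable def oneFrame : FormFrame 1 where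
  form i := detForm ![coordFun i]
  vec i := ![edge i]
  form_vec i j := by
    rw [detForm_one]
    exact edge_castSucc j i
  expand ω := by
    refine Module.Basis.ext_alternating edgeBasis fun v _ => ?_
    have hv : (fun l => edgeBasis (v l)) = ![edge (v 0)] := by
      funext l
      rw [Subsingleton.elim l 0]
      rfl
    rw [hv, alternatingMap_sum_apply, Finset.sum_eq_single (v 0)]
    · change _ = _ * detForm ![coordFun (v 0)] _
      rw [detForm_one]
      simp [edge_castSucc]
    · intro i _ hi
      change _ * detForm ![coordFun i] _ = 0
      rw [detForm_one]
      simp [edge_castSucc, hi]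
    · simp
  form_perm i v := by
    rw [detForm_one, detForm_one]
    exact permVec_threeCycle _ _

/-- The frame `dλ_1 ∧ dλ_2, dλ_2 ∧ dλ_0, dλ_0 ∧ dλ_1` of `2`-forms. -/
noncomputable def twoFrame : FormFrame 2 where
  form i := detForm ![coordFun (i + 1), coordFun (i + 2)]
  vec i := ![edge (i + 1), edge (i + 2)]
  form_vec i j := by
    rw [detForm_two]
    simp only [coordFun_apply, Matrix.cons_val, edge_castSucc]
    revert i j
    simp only [Fin.forall_fin_succ]
    simp
  expand ω := by
    refine Module.Basis.ext_alternating edgeBasis fun v hv => ?_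
    have hv' : (fun l => edgeBasis (v l)) = ![edge (v 0), edge (v 1)] := by
      funext l
      fin_cases l <;> rfl
    have hswap (i j : Fin 3) : ω ![edge i, edge j] = - ω ![edge j, edge i] := by
      rw [← ω.map_swap _ (zero_ne_one (α := Fin 2))]
      congr 1
      funext l
      fin_cases l <;> rfl
    have hne : v 0 ≠ v 1 := fun h => zero_ne_one (hv h)
    rw [hv', alternatingMap_sum_apply]
    change _ = ∑ i, _ * detForm ![coordFun (i + 1), coordFun (i + 2)] _
    simp only [detForm_two, Submodule.subtype_apply, coordFun_apply,
      Matrix.cons_val, edge_castSucc, Fin.sum_univ_three]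
    generalize v 0 = a at *
    generalize v 1 = b at *
    fin_cases a <;> fin_cases b <;> simp at hne ⊢
    all_goals exact hswap _ _
  form_perm i v := by
    rw [detForm_two, detForm_two]
    simp only [coordFun_apply, permVec_threeCycle]
    rw [add_right_comm i 2 1]

end Frames

/-! ### Vanishing boundary traces in terms of vector fields -/

section Traces

/-- The face λ_i = 0 with i < 3 has tangent vectors `edge j`, j ≠ i, which read off single
components. The last face is spanned by the differences `edge 0 - edge j`. -/
lemma mem_vanishingTrace_oneFrame (u : Field3) :
    oneFrame.toForm u ∈ (vanishingTrace 3 1).toSubmodule ↔ VanishesTangentially u := by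
  have happ (x : Simplex 3) (v : Fin 1 → tangent 3) : oneFrame.toForm u x v
      = ∑ i : Fin 3, eval (coords x) (u i) * (v 0 : Vec 3) i.castSucc := by
    rw [FormFrame.toForm_apply]
    exact Finset.sum_congr rfl fun i _ => congrArg _ (detForm_one _ _)
  rw [mem_vanishingTrace]
  constructor
  · refine fun h => ⟨fun i j hij => X_dvd_of_eval_coords fun x hx => ?_,
      fun j => lam_dvd_of_eval_coords fun x hx => ?_⟩
    · rw [← oneFrame.toForm_vec]
      refine h _ x hx _ fun l => ?_
      change (![edge j] l : Vec 3) _ = 0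
      rw [Subsingleton.elim l 0]
      exact (edge_castSucc j i).trans (if_neg hij.symm)
    · have := h 3 x hx ![edge 0 - edge j] fun l => by
        rw [Subsingleton.elim l 0, tangent_three]
        change -((edge 0 : Vec 3) (0 : Fin 3).castSucc - (edge j : Vec 3) (0 : Fin 3).castSucc)
          - ((edge 0 : Vec 3) (1 : Fin 3).castSucc - (edge j : Vec 3) (1 : Fin 3).castSucc)
          - ((edge 0 : Vec 3) (2 : Fin 3).castSucc - (edge j : Vec 3) (2 : Fin 3).castSucc) = 0
        simp only [edge_castSucc]
        fin_cases j <;> simp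
      rw [happ] at this
      rw [map_sub, ← this]
      change _ = ∑ i : Fin 3, eval (coords x) (u i) *
        ((edge 0 : Vec 3) i.castSucc - (edge j : Vec 3) i.castSucc)
      simp [edge_castSucc, mul_sub]
  · rintro ⟨hX, hl⟩ i x hx v hv
    rw [happ]
    refine Fin.lastCases (fun hx hv => ?_) (fun i hx hv => ?_) i hx hv
    · have hlam : eval (coords x) lam = 0 := by
        rw [eval_lam, ← simplex_sum]
        exact hx
      have he (j : Fin 3) : eval (coords x) (u j) = eval (coords x) (u 0) := by
        obtain ⟨d, hd⟩ := hl j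
        have := congrArg (eval (coords x)) hd
        rw [map_sub, map_mul, hlam, zero_mul, sub_eq_zero] at this
        exact this.symm
      simp only [he, ← Finset.mul_sum]
      have h3 := (tangent_three (v 0)).symm.trans (hv 0)
      rw [Fin.sum_univ_three]
      change _ * ((v 0 : Vec 3) 0 + (v 0 : Vec 3) 1 + (v 0 : Vec 3) 2) = 0
      rw [show (v 0 : Vec 3) 0 + (v 0 : Vec 3) 1 + (v 0 : Vec 3) 2 = 0 by linarith, mul_zero]
    · refine Finset.sum_eq_zero fun j _ => ?_
      by_cases hij : j = i
      · subst hij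
        rw [hv 0, mul_zero]
      · obtain ⟨d, hd⟩ := hX i j hij
        have : eval (coords x) (X i) = 0 := by
          rw [eval_X]
          exact hx
        rw [hd, map_mul, this, zero_mul, zero_mul]

/-- Each face has one tangent bivector up to scale. On the last face (e_0 - e_1) ∧ (e_1 - e_2) = e_0
∧ e_1 + e_1 ∧ e_2 + e_2 ∧ e_0 evaluates to the sum of the components. -/
lemma mem_vanishingTrace_twoFrame (u : Field3) :
    twoFrame.toForm u ∈ (vanishingTrace 3 2).toSubmodule ↔ VanishesNormally u := by
  have happ (x : Simplex 3) (v : Fin 2 → tangent 3) : twoFrame.toForm u x v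
      = ∑ i : Fin 3, eval (coords x) (u i) *
        ((v 0 : Vec 3) (i + 1).castSucc * (v 1 : Vec 3) (i + 2).castSucc
          - (v 0 : Vec 3) (i + 2).castSucc * (v 1 : Vec 3) (i + 1).castSucc) := by
    rw [FormFrame.toForm_apply]
    exact Finset.sum_congr rfl fun i _ => congrArg _ (detForm_two _ _ _)
  rw [mem_vanishingTrace]
  constructor
  · refine fun h => ⟨fun i => X_dvd_of_eval_coords fun x hx => ?_,
      lam_dvd_of_eval_coords fun x hx => ?_⟩
    · rw [← twoFrame.toForm_vec]
      refine h _ x hx _ fun l => ?_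
      change (![edge (i + 1), edge (i + 2)] l : Vec 3) _ = 0
      have hne : i ≠ i + 1 ∧ i ≠ i + 2 := by
        clear hx
        revert i
        decide
      fin_cases l
      · exact (edge_castSucc (i + 1) i).trans (if_neg hne.1)
      · exact (edge_castSucc (i + 2) i).trans (if_neg hne.2)
    · have hz (i j : Fin 3) : ((edge i - edge j : tangent 3) : Vec 3) 3 = 0 := by
        rw [tangent_three]
        change -((edge i : Vec 3) (0 : Fin 3).castSucc - (edge j : Vec 3) (0 : Fin 3).castSucc)
          - ((edge i : Vec 3) (1 : Fin 3).castSucc - (edge j : Vec 3) (1 : Fin 3).castSucc)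
          - ((edge i : Vec 3) (2 : Fin 3).castSucc - (edge j : Vec 3) (2 : Fin 3).castSucc) = 0
        simp only [edge_castSucc]
        fin_cases i <;> fin_cases j <;> simp
      have := h 3 x hx ![edge 0 - edge 1, edge 1 - edge 2] fun l => by
        fin_cases l
        exacts [hz 0 1, hz 1 2]
      rw [happ] at this
      rw [map_add, map_add, ← this]
      change _ = ∑ i : Fin 3, eval (coords x) (u i) *
        (((edge 0 : Vec 3) (i + 1).castSucc - (edge 1 : Vec 3) (i + 1).castSucc)
          * ((edge 1 : Vec 3) (i + 2).castSucc - (edge 2 : Vec 3) (i + 2).castSucc)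
        - ((edge 0 : Vec 3) (i + 2).castSucc - (edge 1 : Vec 3) (i + 2).castSucc)
          * ((edge 1 : Vec 3) (i + 1).castSucc - (edge 2 : Vec 3) (i + 1).castSucc))
      simp [edge_castSucc, Fin.sum_univ_three]
  · rintro ⟨hX, hl⟩ i x hx v hv
    rw [happ]
    refine Fin.lastCases (fun hx hv => ?_) (fun i hx hv => ?_) i hx hv
    · have hlam : eval (coords x) lam = 0 := by
        rw [eval_lam, ← simplex_sum]
        exact hx
      have he : eval (coords x) (u 0) + eval (coords x) (u 1) + eval (coords x) (u 2) = 0 := by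
        obtain ⟨d, hd⟩ := hl
        have := congrArg (eval (coords x)) hd
        rwa [map_add, map_add, map_mul, hlam, zero_mul] at this
      have h0 := (tangent_three (v 0)).symm.trans (hv 0)
      have h1 := (tangent_three (v 1)).symm.trans (hv 1)
      rw [Fin.sum_univ_three]
      change _ * ((v 0 : Vec 3) 1 * (v 1 : Vec 3) 2 - (v 0 : Vec 3) 2 * (v 1 : Vec 3) 1)
        + _ * ((v 0 : Vec 3) 2 * (v 1 : Vec 3) 0 - (v 0 : Vec 3) 0 * (v 1 : Vec 3) 2)
        + _ * ((v 0 : Vec 3) 0 * (v 1 : Vec 3) 1 - (v 0 : Vec 3) 1 * (v 1 : Vec 3) 0) = 0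
      have h0' : (v 0 : Vec 3) 2 = -(v 0 : Vec 3) 0 - (v 0 : Vec 3) 1 := by linarith
      have h1' : (v 1 : Vec 3) 2 = -(v 1 : Vec 3) 0 - (v 1 : Vec 3) 1 := by linarith
      rw [h0', h1']
      linear_combination
        ((v 0 : Vec 3) 0 * (v 1 : Vec 3) 1 - (v 0 : Vec 3) 1 * (v 1 : Vec 3) 0) * he
    · refine Finset.sum_eq_zero fun j _ => ?_
      have hij : ∀ i j : Fin 3, i = j ∨ i = j + 1 ∨ i = j + 2 := by decide
      have := hij i j
      rcases this with rfl | rfl | rfl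
      · obtain ⟨d, hd⟩ := hX i
        have : eval (coords x) (X i) = 0 := by
          rw [eval_X]
          exact hx
        rw [hd, map_mul, this, zero_mul, zero_mul]
      · rw [hv 0, hv 1]
        ring
      · rw [hv 0, hv 1]
        ring

end Traces

/-! ### Trimmed forms as vector fields -/

section TrimmedForms

lemma constForm_mem {k : ℕ} {r : ℤ} {p : MvPolynomial (Fin 4) ℝ} (hp : p ∈ polyLE 3 r)
    (c : Vec 3 [⋀^Fin k]→ₗ[ℝ] ℝ) :
    (fun x => eval x p • c) ∈ polyFormsAmbient 3 r k := fun v =>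
  ⟨c v • p, Submodule.smul_mem _ _ hp, fun x => by simp [mul_comm]⟩

/-- Splitting the position vector into a vertex and edge directions separates a contraction into a
part of degree r - 1 and a part with explicit factors x_j. -/
lemma simplex_eq (x : Simplex 3) :
    (x : Vec 3) = Pi.single 3 1 + ∑ j : Fin 3, coords x j • (edge j : Vec 3) := by
  have h3 (j : Fin 3) : (edge j : Vec 3) 3 = -1 := by
    rw [tangent_three]
    change -(edge j : Vec 3) (0 : Fin 3).castSucc - (edge j : Vec 3) (1 : Fin 3).castSucc
      - (edge j : Vec 3) (2 : Fin 3).castSucc = -1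
    simp only [edge_castSucc]
    fin_cases j <;> simp
  funext i
  rw [Pi.add_apply, Finset.sum_apply]
  refine Fin.lastCases ?_ (fun i => ?_) i
  · change (x : Vec 3) 3 = (Pi.single 3 1 : Vec 3) 3 + ∑ j : Fin 3, coords x j * (edge j : Vec 3) 3
    rw [simplex_sum, Pi.single_eq_same, Fin.sum_univ_three, h3, h3, h3]
    ring
  · have hi : i.castSucc ≠ (3 : Fin 4) := by revert i; decide
    simp [hi, edge_castSucc]
    rfl

/-- The proxy field of the contraction of a polynomial form. -/
lemma exists_contract_eq {k : ℕ} (F : FormFrame k) {r : ℤ} {ω : SimplexForm 3 k}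
    (hω : ω ∈ (trimmedForms 3 r k).toSubmodule) :
    ∃ α : Form (Vec 3) (Vec 3) (k + 1), ∃ (B : Field3) (A : Fin 3 → Field3),
      (∀ i, B i ∈ polyLE 2 (r - 1)) ∧ (∀ j i, A j i ∈ polyLE 2 (r - 1)) ∧
      (∀ (x : Simplex 3) j i, eval (coords x) (A j i)
        = α x (Fin.cons (edge j : Vec 3) fun l => (F.vec i l : Vec 3))) ∧
      F.toForm (fun i => B i + ∑ j, X j * A j i) = ω := by
  obtain ⟨_, ⟨α, hα, rfl⟩, rfl⟩ := hω
  choose b hb hb' using fun i => hα (Fin.cons (Pi.single 3 1) fun l => (F.vec i l : Vec 3))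
  choose a ha ha' using fun j i => hα (Fin.cons (edge j : Vec 3) fun l => (F.vec i l : Vec 3))
  refine ⟨α, fun i => restrictPoly (b i), fun j i => restrictPoly (a j i),
    fun i => restrictPoly_mem (hb i), fun j i => restrictPoly_mem (ha j i),
    fun x j i => by rw [eval_restrictPoly, ha'], Eq.symm (F.eq_toForm fun x i => ?_)⟩
  change (α x).curryLeft (x : Vec 3) (fun l => (F.vec i l : Vec 3)) = _
  simp only [map_add, map_sum, map_mul, eval_X, eval_restrictPoly, ← hb', ← ha']
  generalize α (x : Vec 3) = β
  rw [simplex_eq x, map_add, map_sum]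
  simp only [map_smul, AlternatingMap.add_apply, alternatingMap_sum_apply]
  rfl

lemma restrict_contractX_apply {k : ℕ} (α : Form (Vec 3) (Vec 3) (k + 1)) (x : Simplex 3)
    (v : Fin k → tangent 3) : restrict 3 k (contractX 3 k α) x v
      = α (x : Vec 3) (Fin.cons (x : Vec 3) fun l => (v l : Vec 3)) := rfl

lemma sum_tangent_eq_zero (v : tangent 3) : ∑ i, (v : Vec 3) i = 0 := v.2

/-- The differential of the sum of all barycentric coordinates. -/
def sumFun : Vec 3 →ₗ[ℝ] ℝ := ∑ i, LinearMap.proj i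

lemma sumFun_tangent (v : tangent 3) : sumFun (v : Vec 3) = 0 := by
  simp [sumFun, sum_tangent_eq_zero]

lemma sumFun_simplex (x : Simplex 3) : sumFun (x : Vec 3) = 1 := by
  have : ∑ i, (x : Vec 3) i = 1 := x.2.2
  simp [sumFun, this]

/-- The edge part of a contraction is antisymmetric, hence drops out of x · u and leaves degree at
most r. Conversely x · u = x · B with B of degree r - 1, and u - B is a cross product with x by
Koszul exactness. -/
lemma mem_trimmedForms_one {r : ℤ} (ω : SimplexForm 3 1) :
    ω ∈ (trimmedForms 3 r 1).toSubmodule ↔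
      ∃ u, IsTrimmedTangential r u ∧ oneFrame.toForm u = ω := by
  constructor
  · intro h
    obtain ⟨α, B, A, hB, hA, hαA, rfl⟩ := exists_contract_eq oneFrame h
    have hanti (i j : Fin 3) : A i j = -A j i := by
      rw [← add_eq_zero_iff_eq_neg]
      refine eq_zero_of_eval_coords fun x => ?_
      rw [map_add, hαA, hαA, add_eq_zero_iff_eq_neg, ← (α x).map_swap _ (zero_ne_one (α := Fin 2))]
      congr 1
      funext l
      fin_cases l <;> rfl
    have hself (i : Fin 3) : A i i = 0 := self_eq_neg.1 (hanti i i)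
    have hup (i : Fin 3) (p) (hp : p ∈ polyLE 2 (r - 1)) : X i * p ∈ polyLE 2 r := by
      rw [← sub_add_cancel r 1, X_mul_mem_polyLE_iff]
      exact hp
    refine ⟨_, ⟨fun i => add_mem (polyLE_mono (by omega) (hB i)) (sum_mem fun j _ =>
      hup _ _ (hA j i)), ?_⟩, rfl⟩
    have : radial (fun i => B i + ∑ j, X j * A j i) = X 0 * B 0 + X 1 * B 1 + X 2 * B 2 := by
      simp only [radial, Fin.sum_univ_three, hself, hanti 1 0, hanti 2 0, hanti 2 1]
      ring
    rw [this]
    exact add_mem (add_mem (hup _ _ (hB 0)) (hup _ _ (hB 1))) (hup _ _ (hB 2))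
  · rintro ⟨u, ⟨hu, hr⟩, rfl⟩
    rw [← sub_add_cancel r 1] at hr hu
    obtain ⟨B, hB, hBu⟩ := exists_radial_eq hr (by simp [radial])
    obtain ⟨w, hw, hwu⟩ := exists_cross_eq (u := u - B) (m := r - 1)
      (fun i => sub_mem (hu i) (polyLE_mono (by omega) (hB i))) (by
        have : radial (u - B) = radial u - radial B := by
          simp only [radial, Pi.sub_apply]
          ring
        rw [this, hBu, sub_self])
    -- With σ the sum of all coordinates, σ = 1 and dσ = 0 on the tetrahedron, so contracting dσ ∧
    -- dλ_i restricts to dλ_i and produces B. The terms dλ_{i+1} ∧ dλ_{i+2} produce the cross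
    -- product.
    refine ⟨_, ⟨∑ i, ((fun x => eval x (rename Fin.castSucc (B i)) •
      detForm ![sumFun, coordFun i]) + fun x => eval x (rename Fin.castSucc (w i)) •
      detForm ![coordFun (i + 1), coordFun (i + 2)]),
      sum_mem fun i _ => add_mem (constForm_mem (rename_castSucc_mem (hB i)) _)
        (constForm_mem (rename_castSucc_mem (hw i)) _), rfl⟩, ?_⟩
    refine oneFrame.eq_toForm fun x i => ?_
    have hv : (Fin.cons (x : Vec 3) fun l => (oneFrame.vec i l : Vec 3) : Fin 2 → Vec 3)
        = ![(x : Vec 3), (edge i : Vec 3)] := by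
      funext l
      fin_cases l <;> rfl
    have hui : u i = B i + (w (i + 1) * X (i + 2) - w (i + 2) * X (i + 1)) := by
      rw [← hwu, Pi.sub_apply]
      ring
    rw [restrict_contractX_apply, hv, hui, Finset.sum_apply, alternatingMap_sum_apply]
    simp only [Pi.add_apply, AlternatingMap.add_apply, AlternatingMap.smul_apply, detForm_two,
      Matrix.cons_val, sumFun_simplex, sumFun_tangent, coordFun_apply, edge_castSucc,
      eval_rename_castSucc, smul_eq_mul, map_add, map_sub, map_mul, eval_X, Fin.sum_univ_three]
    change _ = _ + (_ * (x : Vec 3) (i + 2).castSucc - _ * (x : Vec 3) (i + 1).castSucc)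
    fin_cases i <;> simp <;> ring

/-- A 3-form evaluated on edges is alternating, so the edge part of the contraction is x times its
single value on the three edges. -/
lemma mem_trimmedForms_two {r : ℤ} (ω : SimplexForm 3 2) :
    ω ∈ (trimmedForms 3 r 2).toSubmodule ↔
      ∃ u, IsTrimmedNormal r u ∧ twoFrame.toForm u = ω := by
  constructor
  · intro h
    obtain ⟨α, B, A, hB, hA, hαA, rfl⟩ := exists_contract_eq twoFrame h
    have hoff (i j : Fin 3) (hij : j ≠ i) : A j i = 0 := by
      refine eq_zero_of_eval_coords fun x => ?_
      rw [hαA]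
      have : j = i + 1 ∨ j = i + 2 := by revert i j; decide
      rcases this with rfl | rfl
      · exact (α x).map_eq_zero_of_eq _ (i := 0) (j := 1) rfl (by decide)
      · exact (α x).map_eq_zero_of_eq _ (i := 0) (j := 2) rfl (by decide)
    have hdiag (i : Fin 3) : A (i + 1) (i + 1) = A i i := by
      rw [← sub_eq_zero]
      refine eq_zero_of_eval_coords fun x => ?_
      rw [map_sub, hαA, hαA, sub_eq_zero]
      have := (α x).map_perm (Fin.cons (edge i : Vec 3) fun l => (twoFrame.vec i l : Vec 3))
        (finRotate 3)
      rw [sign_finRotate, Even.neg_one_pow (by decide), one_smul] at this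
      rw [← this]
      congr 1
      have h3 : ∀ i : Fin 3, i + 1 + 2 = i := by decide
      funext l
      fin_cases l
      · rfl
      · change (edge (i + 1 + 1) : Vec 3) = edge (i + 2)
        rw [add_assoc]
        rfl
      · change (edge (i + 1 + 2) : Vec 3) = edge i
        rw [h3]
    have h1 : A 1 1 = A 0 0 := hdiag 0
    have h2 : A 2 2 = A 0 0 := (hdiag 1).trans h1
    refine ⟨_, ⟨B, A 0 0, hB, hA 0 0, fun i => ?_⟩, rfl⟩
    rw [Finset.sum_eq_single i (fun j _ hj => by rw [hoff i j hj, mul_zero]) (by simp)]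
    fin_cases i
    · rfl
    · exact congrArg (fun p => _ + X 1 * p) h1
    · exact congrArg (fun p => _ + X 2 * p) h2
  · rintro ⟨u, ⟨w, f, hw, hf, hu⟩, rfl⟩
    refine ⟨_, ⟨(∑ i, fun x => eval x (rename Fin.castSucc (w i)) •
      detForm ![sumFun, coordFun (i + 1), coordFun (i + 2)])
      + fun x => eval x (rename Fin.castSucc f) •
      detForm ![coordFun 0, coordFun 1, coordFun 2],
      add_mem (sum_mem fun i _ => constForm_mem (rename_castSucc_mem (hw i)) _)
        (constForm_mem (rename_castSucc_mem hf) _), rfl⟩, ?_⟩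
    refine twoFrame.eq_toForm fun x i => ?_
    have hv : (Fin.cons (x : Vec 3) fun l => (twoFrame.vec i l : Vec 3) : Fin 3 → Vec 3)
        = ![(x : Vec 3), (edge (i + 1) : Vec 3), (edge (i + 2) : Vec 3)] := by
      funext l
      fin_cases l <;> rfl
    rw [restrict_contractX_apply, hv, hu, Pi.add_apply, Finset.sum_apply,
      AlternatingMap.add_apply, alternatingMap_sum_apply]
    simp only [AlternatingMap.smul_apply, detForm_three,
      Matrix.cons_val, sumFun_simplex, sumFun_tangent, coordFun_apply, edge_castSucc,
      eval_rename_castSucc, smul_eq_mul, map_add, map_mul, eval_X, Fin.sum_univ_three]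
    change _ = _ + (x : Vec 3) i.castSucc * _
    fin_cases i <;> simp <;> ring

end TrimmedForms

lemma hasInvBasis_iff {k : ℕ} {W : Subrepresentation (simplexRep 3 k)}
    (h : FiniteDimensional ℝ W.toSubmodule) :
    HasInvBasis W ↔ 0 ≤ LinearMap.trace ℝ W.toSubmodule (W.toRepresentation threeCycle) :=
  hasInvariantBasis_iff_trace_nonneg

lemma mem_inf_vanishingTrace {k : ℕ} {F : FormFrame k} {W : Subrepresentation (simplexRep 3 k)}
    {P Q : Field3 → Prop} (hP : ∀ ω, ω ∈ W.toSubmodule ↔ ∃ u, P u ∧ F.toForm u = ω)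
    (hQ : ∀ u, F.toForm u ∈ (vanishingTrace 3 k).toSubmodule ↔ Q u) (ω : SimplexForm 3 k) :
    ω ∈ (W ⊓ vanishingTrace 3 k).toSubmodule ↔ ∃ u, (P u ∧ Q u) ∧ F.toForm u = ω := by
  rw [Subrepresentation.toSubmodule_inf, Submodule.mem_inf, hP]
  constructor
  · rintro ⟨⟨u, hu, rfl⟩, hv⟩
    exact ⟨u, ⟨hu, (hQ u).1 hv⟩, rfl⟩
  · rintro ⟨u, ⟨hu, hv⟩, rfl⟩
    exact ⟨⟨u, hu, rfl⟩, (hQ u).2 hv⟩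

end FEEC

theorem theorem4p2 (r : ℤ) :
    FEEC.HasInvBasis (FEEC.polyForms 3 r 1) ∧
    (FEEC.HasInvBasis (FEEC.trimmedForms 3 r 1) ↔
      ¬ ∃ m : ℕ, r = 3 * (m : ℤ) + 2) ∧
    FEEC.HasInvBasis (FEEC.polyForms 3 r 2) ∧
    FEEC.HasInvBasis (FEEC.trimmedForms 3 r 2) ∧
    FEEC.HasInvBasis (FEEC.polyForms₀ 3 r 1) ∧
    FEEC.HasInvBasis (FEEC.trimmedForms₀ 3 r 1) ∧
    (FEEC.HasInvBasis (FEEC.polyForms₀ 3 r 2) ↔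
      ¬ ∃ m : ℕ, r = 3 * (m : ℤ) + 3) ∧
    FEEC.HasInvBasis (FEEC.trimmedForms₀ 3 r 2) := by
  open FEEC in
  have i1 := oneFrame.toForm_injective
  have i2 := twoFrame.toForm_injective
  have r1 := oneFrame.toForm_rotField
  have r2 := twoFrame.toForm_rotField
  have p1 := oneFrame.mem_polyForms (r := r)
  have p2 := twoFrame.mem_polyForms (r := r)
  have h1 := trace_full i1 r1 p1
  have h2 := trace_trimmedTangential i1 r1 (mem_trimmedForms_one (r := r))
  have h3 := trace_full i2 r2 p2
  have h4 := trace_trimmedNormal i2 r2 (mem_trimmedForms_two (r := r))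
  have h5 := trace_fullTangential₀ i1 r1 (mem_inf_vanishingTrace p1 mem_vanishingTrace_oneFrame)
  have h6 := trace_trimmedTangential₀ i1 r1
    (mem_inf_vanishingTrace (mem_trimmedForms_one (r := r)) mem_vanishingTrace_oneFrame)
  have h7 := trace_fullNormal₀ i2 r2 (mem_inf_vanishingTrace p2 mem_vanishingTrace_twoFrame)
  have h8 := trace_trimmedNormal₀ i2 r2
    (mem_inf_vanishingTrace (mem_trimmedForms_two (r := r)) mem_vanishingTrace_twoFrame)
  refine ⟨(hasInvBasis_iff h1.1).2 h1.2.ge, (hasInvBasis_iff h2.1).trans (h2.2.trans ?_),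
    (hasInvBasis_iff h3.1).2 h3.2.ge, (hasInvBasis_iff h4.1).2 h4.2,
    (hasInvBasis_iff h5.1).2 h5.2, (hasInvBasis_iff h6.1).2 h6.2.ge,
    (hasInvBasis_iff h7.1).trans (h7.2.trans ?_), (hasInvBasis_iff h8.1).2 h8.2.ge⟩
  · refine not_congr ⟨fun ⟨h0, h⟩ => ⟨(r / 3).toNat, ?_⟩, fun ⟨m, hm⟩ => ?_⟩ <;> omega
  · refine not_congr ⟨fun ⟨h0, h⟩ => ⟨(r / 3 - 1).toNat, ?_⟩, fun ⟨m, hm⟩ => ?_⟩ <;> omega
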